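/- All systems are finite-dimensional, with fixed orthonormal computational bases; an operation (channel) is a completely positive trace-preserving linear map. Let $\mathcal N$ be an operation from a (non-zero) system $A'$ to a system $B$, let $N_{A'B}=\sum_{i,j}|i\rangle\langle j|\otimes\mathcal N(|i\rangle\langle j|)$ be its Choi matrix, and let $K\ge 1$ be an integer. A forward-assisted code of size $K$ consists of systems $Q,R$ of arbitrary finite dimension and operations $\mathcal E: A\to A'Q$ (encoder), $\mathcal F: Q\to R$ (side channel) and $\mathcal D: RB\to B'$ (decoder), where $\dim A=\dim B'=K$. Applied to $\mathcal N$ it gives the operation $\mathcal M=\mathcal D\,\mathcal F\,\mathcal N\,\mathcal E$ from $A$ to $B'$ (identity maps on the remaining systems are suppressed), with channel fidelity $\mathrm{Tr}\,\phi_{B'\tilde A}\,\mathcal M\phi_{A\tilde A}$, where $\dim\tilde A=K$, $\phi=|\phi\rangle\langle\phi|$ and $|\phi\rangle=K^{-1/2}\sum_{i=1}^K|i\rangle|i\rangle$. The code also defines the bipartite operation $\mathcal Z=\mathcal D\mathcal F\mathcal E$ from $AB$ to $A'B'$, where Alice holds $A,A'$ and Bob holds $B,B'$. The code is non-signalling ($\mathbf{NS}$)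 if $\mathrm{Tr}_{A'}\mathcal Z=\mathcal Z^{\mathrm{Bob}}\,\mathrm{Tr}_A$ for some operation $\mathcal Z^{\mathrm{Bob}}$ from $B$ to $B'$. It is PPT-preserving ($\mathbf{PPTp}$) if, for all finite-dimensional ancillas $\tilde A$ (with Alice) and $\tilde B$ (with Bob) and every state $\sigma$ of $A\tilde AB\tilde B$ whose partial transpose on $B\tilde B$ is positive semidefinite, the partial transpose on $B'\tilde B$ of $\mathcal Z\sigma$ is positive semidefinite. For $\Omega\in\{\mathbf{NS},\ \mathbf{PPTp},\ \mathbf{NS}\cap\mathbf{PPTp}\}$, let $F^{\Omega}(\mathcal N,K)$ be the maximum channel fidelity obtained by applying codes of size $K$ in the class $\Omega$ to $\mathcal N$. Then, for each of the three classes $\Omega$, the maximum $F^{\Omega}(\mathcal N,K)$ is attained and equals the (attained) maximum of $\mathrm{Tr}\,N_{A'B}^{\mathrm T}\Lambda_{A'B}$ over pairs $(\rho_{A'},\Lambda_{A'B})$ of Hermitian operators satisfying $$\rho_{A'}\ge 0,\qquad \mathrm{Tr}\,\rho_{A'}=1,\qquad \Lambda_{A'B}\ge 0,\qquad \Lambda_{A'B}\le\rho_{A'}\otimes\mathbb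 1_B,$$ together with the constraint $$\mathbf{NS}:\quad \mathrm{Tr}_{A'}\Lambda_{A'B}=\mathbb 1_B/K^2$$ if $\Omega=\mathbf{NS}$, the constraints $$\mathbf{PPTp}:\quad -\rho_{A'}\otimes\mathbb 1_B/K\ \le\ \mathbf t_B[\Lambda_{A'B}]\ \le\ \rho_{A'}\otimes\mathbb 1_B/K$$ ($\mathbf t_B$ is the partial transpose on $B$) if $\Omega=\mathbf{PPTp}$, and all of these constraints if $\Omega=\mathbf{NS}\cap\mathbf{PPTp}$. Each of these three optimisations is a semidefinite program: the maximisation of a real-linear functional over the points $x$ of a finite-dimensional real vector space that satisfy a linear matrix inequality $F_0+L(x)\ge 0$, with $F_0$ Hermitian and $L$ real-linear with Hermitian values. -/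

import Mathlib

open scoped Kronecker ComplexOrder

namespace QCode

noncomputable section

/-! ### Operations on finite-dimensional quantum systems

A quantum system is given by the finite index type of its computational basis; operators on it are
complex matrices, and a joint system is given by the product of the index types. -/

/-- Operators on the system with basis `Q`. -/
abbrev Mat (Q : Type*) := Matrix Q Q ℂ

/-- `Φ ⊗ id_S`: the map `Φ` applied to the left factor of a joint system. -/
def onLeft {Q R : Type*} (S : Type*) (Φ : Mat Q →ₗ[ℂ] Mat R) :
    Mat (Q × S) →ₗ[ℂ] Mat (R × S) where
  toFun X := Matrix.of fun r r' => Φ (Matrix.of fun q q' => X (q, r.2) (q', r'.2)) r.1 r'.1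
  map_add' X Y := by
    ext r r'
    have h : (Matrix.of fun q q' => (X + Y) (q, r.2) (q', r'.2) : Mat Q)
        = (Matrix.of fun q q' => X (q, r.2) (q', r'.2))
          + Matrix.of fun q q' => Y (q, r.2) (q', r'.2) := rfl
    simp only [Matrix.of_apply, Matrix.add_apply] at h ⊢
    rw [h, map_add, Matrix.add_apply]
  map_smul' c X := by
    ext r r'
    have h : (Matrix.of fun q q' => (c • X) (q, r.2) (q', r'.2) : Mat Q)
        = c • (Matrix.of fun q q' => X (q, r.2) (q', r'.2)) := rfl
    simp only [Matrix.of_apply, Matrix.smul_apply, RingHom.id_apply] at h ⊢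
    rw [h, map_smul, Matrix.smul_apply]

/-- `id_S ⊗ Φ`: the map `Φ` applied to the right factor of a joint system. -/
def onRight {Q R : Type*} (S : Type*) (Φ : Mat Q →ₗ[ℂ] Mat R) :
    Mat (S × Q) →ₗ[ℂ] Mat (S × R) where
  toFun X := Matrix.of fun r r' => Φ (Matrix.of fun q q' => X (r.1, q) (r'.1, q')) r.2 r'.2
  map_add' X Y := by
    ext r r'
    have h : (Matrix.of fun q q' => (X + Y) (r.1, q) (r'.1, q') : Mat Q)
        = (Matrix.of fun q q' => X (r.1, q) (r'.1, q'))
          + Matrix.of fun q q' => Y (r.1, q) (r'.1, q') := rfl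
    simp only [Matrix.of_apply, Matrix.add_apply] at h ⊢
    rw [h, map_add, Matrix.add_apply]
  map_smul' c X := by
    ext r r'
    have h : (Matrix.of fun q q' => (c • X) (r.1, q) (r'.1, q') : Mat Q)
        = c • (Matrix.of fun q q' => X (r.1, q) (r'.1, q')) := rfl
    simp only [Matrix.of_apply, Matrix.smul_apply, RingHom.id_apply] at h ⊢
    rw [h, map_smul, Matrix.smul_apply]

/-- Relabelling of the basis (used to regroup the factors of a joint system). -/
def relabel {Q R : Type*} (e : Q ≃ R) : Mat Q →ₗ[ℂ] Mat R where
  toFun X := X.submatrix e.symm e.symm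
  map_add' _ _ := rfl
  map_smul' _ _ := rfl

/-- Complete positivity: `Φ ⊗ id` preserves positive semidefiniteness for every finite ancilla. -/
def IsCompletelyPositive {Q R : Type*} (Φ : Mat Q →ₗ[ℂ] Mat R) : Prop :=
  ∀ (n : ℕ) (X : Mat (Q × Fin n)), X.PosSemidef → (onLeft (Fin n) Φ X).PosSemidef

/-- A (quantum) operation or channel: a completely positive, trace-preserving linear map. -/
structure IsOperation {Q R : Type*} [Fintype Q] [Fintype R] (Φ : Mat Q →ₗ[ℂ] Mat R) : Prop where
  completelyPositive : IsCompletelyPositive Φ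
  tracePreserving : ∀ X, (Φ X).trace = X.trace

/-- The Choi matrix `∑ |q⟩⟨q'| ⊗ Φ(|q⟩⟨q'|)`, as an operator on (input) ⊗ (output). -/
def choi {Q R : Type*} [DecidableEq Q] (Φ : Mat Q →ₗ[ℂ] Mat R) : Mat (Q × R) :=
  Matrix.of fun x y => Φ (Matrix.single x.1 y.1 1) x.2 y.2

/-- Partial trace over the left factor. -/
def traceLeft {P Q : Type*} [Fintype P] (X : Mat (P × Q)) : Mat Q :=
  Matrix.of fun q q' => ∑ p, X (p, q) (p, q')

/-- Partial transpose on the right factor, in the computational basis. -/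
def transposeRight {P Q : Type*} (X : Mat (P × Q)) : Mat (P × Q) :=
  Matrix.of fun x y => X (x.1, y.2) (y.1, x.2)

/-- Density operators. -/
def IsState {Q : Type*} [Fintype Q] (ρ : Mat Q) : Prop :=
  ρ.PosSemidef ∧ ρ.trace = 1

/-! ### Bipartite operations: input `A : B`, output `A' : B'` (Alice : Bob) -/

/-- Non-signalling from Alice to Bob: Bob's marginal output is the image, under a fixed operation,
of Bob's marginal input. -/
def NonSignallingAliceToBob {A B A' B' : Type*} [Fintype A] [Fintype B] [Fintype A'] [Fintype B']
    (Z : Mat (A × B) →ₗ[ℂ] Mat (A' × B')) : Prop :=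
  ∃ ZBob : Mat B →ₗ[ℂ] Mat B', IsOperation ZBob ∧
    ∀ X, traceLeft (Z X) = ZBob (traceLeft X)

/-- `Z` applied to the `A B` part of a state of `(A Ã) : (B B̃)`, giving an operator on
`(A' Ã) : (B' B̃)`. -/
def applyWithAncillas {A B A' B' : Type*} (a b : Type*)
    (Z : Mat (A × B) →ₗ[ℂ] Mat (A' × B')) :
    Mat ((A × a) × (B × b)) →ₗ[ℂ] Mat ((A' × a) × (B' × b)) :=
  relabel (Equiv.prodProdProdComm A' B' a b) ∘ₗ onLeft (a × b) Z ∘ₗ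
    relabel (Equiv.prodProdProdComm A a B b)

/-- PPT-preserving: with arbitrary ancillas held by Alice and by Bob, every state that is PPT
with respect to the Alice / Bob partition is taken to a PPT operator. -/
def PPTPreserving {A B A' B' : Type*} [Fintype A] [Fintype B]
    (Z : Mat (A × B) →ₗ[ℂ] Mat (A' × B')) : Prop :=
  ∀ (m n : ℕ) (ρ : Mat ((A × Fin m) × (B × Fin n))), IsState ρ →
    (transposeRight ρ).PosSemidef →
    (transposeRight (applyWithAncillas (Fin m) (Fin n) Z ρ)).PosSemidef

/-! ### Forward-assisted codes -/

/-- A forward-assisted code of size `K` for channels from `A'` to `B`: an encoder from `A` (of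
dimension `K`) to `A' Q`, a side channel from `Q` to `R`, and a decoder from `B R` to `B'` (of
dimension `K`). The dimensions of `Q` and `R` are arbitrary. -/
structure ForwardCode (K : ℕ) (A' B : Type*) [Fintype A'] [Fintype B] where
  /-- dimension of the input system `Q` of the side channel -/
  q : ℕ
  /-- dimension of the output system `R` of the side channel -/
  r : ℕ
  /-- the encoder -/
  enc : Mat (Fin K) →ₗ[ℂ] Mat (A' × Fin q)
  /-- the side channel -/
  side : Mat (Fin q) →ₗ[ℂ] Mat (Fin r)
  /-- the decoder -/
  dec : Mat (B × Fin r) →ₗ[ℂ] Mat (Fin K)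
  enc_isOperation : IsOperation enc
  side_isOperation : IsOperation side
  dec_isOperation : IsOperation dec

namespace ForwardCode

variable {K : ℕ} {A' B : Type*} [Fintype A'] [Fintype B]

/-- The overall operation from `A` to `B'` obtained by applying the code to `N`. -/
def overall (C : ForwardCode K A' B) (N : Mat A' →ₗ[ℂ] Mat B) :
    Mat (Fin K) →ₗ[ℂ] Mat (Fin K) :=
  C.dec ∘ₗ onRight B C.side ∘ₗ onLeft (Fin C.q) N ∘ₗ C.enc

/-- The bipartite operation `D F E`, from `A : B` to `A' : B'`, of the code. -/
def bipartite (C : ForwardCode K A' B) :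
    Mat (Fin K × B) →ₗ[ℂ] Mat (A' × Fin K) :=
  onRight A' C.dec ∘ₗ onRight A' (onRight B C.side) ∘ₗ
    relabel ((Equiv.prodAssoc A' (Fin C.q) B).trans
      ((Equiv.refl A').prodCongr (Equiv.prodComm (Fin C.q) B))) ∘ₗ
    onLeft B C.enc

end ForwardCode

/-- The class of non-signalling codes. -/
def codesNS (K : ℕ) (A' B : Type*) [Fintype A'] [Fintype B] : Set (ForwardCode K A' B) :=
  {C | NonSignallingAliceToBob C.bipartite}

/-- The class of PPT-preserving codes. -/
def codesPPTp (K : ℕ) (A' B : Type*) [Fintype A'] [Fintype B] : Set (ForwardCode K A' B) :=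
  {C | PPTPreserving C.bipartite}

/-- The maximally entangled vector `K^{-1/2} ∑ |i⟩|i⟩`. -/
def maxEntVec (K : ℕ) : Fin K × Fin K → ℂ :=
  fun x => if x.1 = x.2 then (((Real.sqrt K)⁻¹ : ℝ) : ℂ) else 0

/-- The maximally entangled state `φ`. -/
def maxEnt (K : ℕ) : Mat (Fin K × Fin K) :=
  Matrix.vecMulVec (maxEntVec K) (star (maxEntVec K))

/-- Channel fidelity `Tr φ (M ⊗ id) φ` (a real number when `M` is an operation). -/
def channelFidelity {K : ℕ} (M : Mat (Fin K) →ₗ[ℂ] Mat (Fin K)) : ℝ :=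
  (maxEnt K * onLeft (Fin K) M (maxEnt K)).trace.re

/-- The channel fidelities reached by applying the codes of the class `Ω` to `N`. -/
def fidelities {K : ℕ} {A' B : Type*} [Fintype A'] [Fintype B]
    (Ω : Set (ForwardCode K A' B)) (N : Mat A' →ₗ[ℂ] Mat B) : Set ℝ :=
  {f | ∃ C ∈ Ω, channelFidelity (C.overall N) = f}

/-- `F^Ω(N, K)`: the largest channel fidelity reached by the codes of the class `Ω`. -/
def optFidelity {K : ℕ} {A' B : Type*} [Fintype A'] [Fintype B]
    (Ω : Set (ForwardCode K A' B)) (N : Mat A' →ₗ[ℂ] Mat B) : ℝ :=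
  sSup (fidelities Ω N)

/-! ### The optimisation problems -/

/-- The real vector space of Hermitian operators. -/
abbrev Herm (Q : Type*) := selfAdjoint (Matrix Q Q ℂ)

/-- The variables: a pair `(ρ, Λ)` of Hermitian operators on `A'` and on `A' B`. -/
abbrev Vars (A' B : Type*) := Herm A' × Herm (A' × B)

section Program

variable {A' B : Type*} [Fintype A'] [Fintype B] [DecidableEq A'] [DecidableEq B]

/-- The objective `Tr Nᵀ Λ`, with `N` the Choi matrix (it is real for `N` an operation). -/
def objective (N : Mat A' →ₗ[ℂ] Mat B) (x : Vars A' B) : ℝ :=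
  ((choi N).transpose * (x.2 : Mat (A' × B))).trace.re

variable (A' B) in
/-- `ρ ≥ 0`, `Tr ρ = 1`, `Λ ≥ 0` and `Λ ≤ ρ ⊗ 1`. -/
def baseConstraints : Set (Vars A' B) :=
  {x | (x.1 : Mat A').PosSemidef ∧ (x.1 : Mat A').trace = 1 ∧
    (x.2 : Mat (A' × B)).PosSemidef ∧
    ((x.1 : Mat A') ⊗ₖ (1 : Mat B) - (x.2 : Mat (A' × B))).PosSemidef}

variable (A' B) in
/-- `Tr_{A'} Λ = 1 / K²`. -/
def constraintNS (K : ℕ) : Set (Vars A' B) :=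
  {x | traceLeft (x.2 : Mat (A' × B)) = ((K : ℂ) ^ 2)⁻¹ • (1 : Mat B)}

variable (A' B) in
/-- `-ρ ⊗ 1 / K ≤ t_B[Λ] ≤ ρ ⊗ 1 / K`. -/
def constraintPPTp (K : ℕ) : Set (Vars A' B) :=
  {x | (transposeRight (x.2 : Mat (A' × B))
        - (-((K : ℂ)⁻¹ • ((x.1 : Mat A') ⊗ₖ (1 : Mat B))))).PosSemidef ∧
    ((K : ℂ)⁻¹ • ((x.1 : Mat A') ⊗ₖ (1 : Mat B))
        - transposeRight (x.2 : Mat (A' × B))).PosSemidef}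

end Program

/-- The problem of optimising `objective` over `feasible` is a semidefinite program: over a
finite-dimensional real vector space, a linear functional is optimised subject to a linear matrix
inequality `F₀ + L x ≥ 0`, with `F₀` Hermitian and `L` real-linear with Hermitian values. (Several
inequalities are one block-diagonal inequality, and an equality is two inequalities.) -/
def IsSemidefiniteProgram {V : Type*} [AddCommGroup V] [Module ℝ V]
    (objective : V → ℝ) (feasible : Set V) : Prop :=
  FiniteDimensional ℝ V ∧
    ∃ (c : V →ₗ[ℝ] ℝ) (n : ℕ) (F₀ : Herm (Fin n)) (L : V →ₗ[ℝ] Herm (Fin n)),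
      (∀ x, objective x = c x) ∧
      feasible = {x | ((F₀ + L x : Herm (Fin n)) : Mat (Fin n)).PosSemidef}

end

end QCode

/-!
The fidelity of a code is a linear function of the Choi matrix `J` of its bipartite operation `Z`,
and it only depends on the contraction `Λ = K⁻² ∑ Z(|c b⟩⟨a b'|)_{(p, c), (p', a)}` of `J` with the
maximally entangled projector on `A B'` (`ForwardCode.channelFidelity_overall`). Since Alice's
output does not depend on Bob's input, contracting `J` with the identity on `A B'` instead gives
`K ρ ⊗ 1`, with `ρ` the average state of the channel input. Now `0 ≤ J`, and for a PPT-preserving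
code `0 ≤ t_B J`, where the partial transposition turns the projector into the flip of `A` and `B'`.
The contraction of positive semidefinite operators is positive semidefinite
(`posSemidef_contractLeft`), so `0 ≤ φ ≤ 1` gives `0 ≤ Λ ≤ ρ ⊗ 1`, and `-1 ≤ flip ≤ 1` gives the
PPT constraints. Being non-signalling fixes the marginal `Tr_{A'} Λ`. This is
`exists_feasible_of_code`.

Conversely, for a feasible `(ρ, Λ)` write `Λ = (S ⊗ 1) E (S ⊗ 1)†` with `S S† = ρ` and `0 ≤ E ≤ 1`
(`exists_effect`). The encoder sends one half of the purification `S` of `ρ` through the channel and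
forwards the other half with the message; the decoder measures the effect `E`, outputs the message
on success, and on failure applies the channel whose Choi matrix is proportional to `1 - φ`. The
resulting bipartite operation has Choi matrix
`entOp ⊗ Λ + (K² - 1)⁻¹ (K 1 - entOp) ⊗ (ρ ⊗ 1 - Λ)` with `entOp = K φ` (`exists_code`). Its
operator `Λ` is the given one, and the two constraints make it non-signalling and PPT-preserving,
the latter because `t_B` of this matrix decomposes over the symmetric and antisymmetric projectors with
coefficients proportional to `ρ ⊗ 1 / K ± t_B Λ`. For `K = 1` there is no failure channel, and `Λ`
is replaced by `ρ ⊗ 1`, which only increases the objective.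

The feasible sets are given by linear matrix inequalities, hence closed, and they are bounded, so
the maxima are attained (`optFidelity_of_feasible`).
-/

namespace QCode

noncomputable section

/-! ### Contractions of positive semidefinite matrices -/

/-- The compression by `∑ q, ⟨q| ⊗ 1`. -/
lemma posSemidef_sum_blocks {Q T : Type*} [Fintype Q] [Fintype T] {Y : Mat (Q × T)}
    (hY : Y.PosSemidef) :
    (Matrix.of fun t t' => ∑ q, ∑ q', Y (q, t) (q', t') : Mat T).PosSemidef := by
  classical
  have h := hY.conjTranspose_mul_mul_same
    (Matrix.of fun (x : Q × T) (t : T) => if x.2 = t then (1 : ℂ) else 0)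
  convert h using 1
  ext t t'
  simp only [Matrix.of_apply, Matrix.mul_apply, Matrix.conjTranspose_apply, Fintype.sum_prod_type]
  simp only [RCLike.star_def, MonoidWithZeroHom.map_ite_one_zero, ite_mul, one_mul, zero_mul,
    mul_ite, mul_one, mul_zero, Finset.sum_ite_eq', Finset.mem_univ, if_true]
  rw [Finset.sum_comm]

/-- Contracting two positive semidefinite operators over a common factor, entry by entry in the
computational basis, gives a positive semidefinite operator: it is a compression of their
Hadamard product. -/
lemma posSemidef_contract {Q R S : Type*} [Fintype Q] [Fintype R] [Fintype S]
    {X : Mat (Q × S)} {C : Mat (Q × R)} (hX : X.PosSemidef) (hC : C.PosSemidef) :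
    (Matrix.of fun r r' => ∑ q, ∑ q', X (q, r.2) (q', r'.2) * C (q, r.1) (q', r'.1) :
      Mat (R × S)).PosSemidef := by
  have h := posSemidef_sum_blocks
    ((hX.submatrix fun x : Q × (R × S) => (x.1, x.2.2)).hadamard
      (hC.submatrix fun x : Q × (R × S) => (x.1, x.2.1)))
  exact h

/-- The contraction of the left factor of `C` against the operator `X`, entry by entry in the
computational basis; it is the partial trace of `(Xᵀ ⊗ 1) C` over the left factor. -/
def contractLeft {Q R : Type*} [Fintype Q] (X : Mat Q) (C : Mat (Q × R)) : Mat R :=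
  Matrix.of fun r r' => ∑ q, ∑ q', X q q' * C (q, r) (q', r')

section contractLeft

variable {Q R : Type*} [Fintype Q]

lemma contractLeft_apply (X : Mat Q) (C : Mat (Q × R)) (r r' : R) :
    contractLeft X C r r' = ∑ q, ∑ q', X q q' * C (q, r) (q', r') := rfl

lemma contractLeft_add (X Y : Mat Q) (C : Mat (Q × R)) :
    contractLeft (X + Y) C = contractLeft X C + contractLeft Y C := by
  ext r r'
  simp [contractLeft_apply, add_mul, Finset.sum_add_distrib]

lemma contractLeft_sub (X Y : Mat Q) (C : Mat (Q × R)) :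
    contractLeft (X - Y) C = contractLeft X C - contractLeft Y C := by
  ext r r'
  simp [contractLeft_apply, sub_mul, Finset.sum_sub_distrib]

lemma contractLeft_smul (c : ℂ) (X : Mat Q) (C : Mat (Q × R)) :
    contractLeft (c • X) C = c • contractLeft X C := by
  ext r r'
  simp [contractLeft_apply, Finset.mul_sum, mul_assoc]

lemma contractLeft_one [DecidableEq Q] (C : Mat (Q × R)) (r r' : R) :
    contractLeft 1 C r r' = ∑ q, C (q, r) (q, r') := by
  simp [contractLeft_apply, Matrix.one_apply]

lemma posSemidef_contractLeft [Fintype R] {X : Mat Q} {C : Mat (Q × R)} (hX : X.PosSemidef)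
    (hC : C.PosSemidef) : (contractLeft X C).PosSemidef := by
  have h := posSemidef_sum_blocks ((hX.submatrix fun x : Q × R => x.1).hadamard hC)
  exact h

end contractLeft

/-- `Matrix.PosSemidef.kronecker` with the structure instances of `ℂ` itself. -/
lemma posSemidef_kronecker {Q R : Type*} [Finite Q] [Finite R] {X : Mat Q} {Y : Mat R}
    (hX : X.PosSemidef) (hY : Y.PosSemidef) : (X ⊗ₖ Y).PosSemidef :=
  hX.kronecker hY

/-! ### Complete positivity and the Choi matrix -/

section Choi

variable {Q R S T : Type*}

/-- The linear map with a given Choi matrix. -/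
def ofChoi [Fintype Q] (C : Mat (Q × R)) : Mat Q →ₗ[ℂ] Mat R where
  toFun X := Matrix.of fun r r' => ∑ q, ∑ q', X q q' * C (q, r) (q', r')
  map_add' X Y := by
    ext r r'
    simp [add_mul, Finset.sum_add_distrib]
  map_smul' c X := by
    ext r r'
    simp [Finset.mul_sum, mul_assoc]

lemma ofChoi_apply [Fintype Q] (C : Mat (Q × R)) (X : Mat Q) (r r' : R) :
    ofChoi C X r r' = ∑ q, ∑ q', X q q' * C (q, r) (q', r') := rfl

lemma ofChoi_single [Fintype Q] [DecidableEq Q] (C : Mat (Q × R)) (q q' : Q) (r r' : R) :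
    ofChoi C (Matrix.single q q' 1) r r' = C (q, r) (q', r') := by
  rw [ofChoi_apply, Finset.sum_eq_single q, Finset.sum_eq_single q']
  · simp
  · intro b _ hb
    simp [hb.symm]
  · simp
  · intro b _ hb
    simp [hb.symm]
  · simp

lemma choi_ofChoi [Fintype Q] [DecidableEq Q] (C : Mat (Q × R)) : choi (ofChoi C) = C := by
  ext x y
  exact ofChoi_single C _ _ _ _

lemma apply_eq_sum_choi [Fintype Q] [DecidableEq Q] (Φ : Mat Q →ₗ[ℂ] Mat R) (X : Mat Q)
    (r r' : R) : Φ X r r' = ∑ q, ∑ q', X q q' * choi Φ (q, r) (q', r') := by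
  conv_lhs => rw [Matrix.matrix_eq_sum_single X]
  simp only [map_sum, Matrix.sum_apply]
  refine Finset.sum_congr rfl fun q _ => Finset.sum_congr rfl fun q' _ => ?_
  rw [show Matrix.single q q' (X q q') = X q q' • Matrix.single q q' (1 : ℂ) by
    simp [Matrix.smul_single], map_smul]
  rfl

/-- One half of Choi's theorem, for ancillas indexed by any finite type. -/
lemma posSemidef_onLeft_of_choi [Fintype Q] [DecidableEq Q] [Fintype R] [Fintype S]
    {Φ : Mat Q →ₗ[ℂ] Mat R} (hΦ : (choi Φ).PosSemidef) {X : Mat (Q × S)} (hX : X.PosSemidef) :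
    (onLeft S Φ X).PosSemidef := by
  convert posSemidef_contract hX hΦ using 1
  ext r r'
  exact apply_eq_sum_choi Φ _ _ _

lemma isCompletelyPositive_of_choi [Fintype Q] [DecidableEq Q] [Fintype R]
    {Φ : Mat Q →ₗ[ℂ] Mat R} (hΦ : (choi Φ).PosSemidef) : IsCompletelyPositive Φ :=
  fun _ _ hX => posSemidef_onLeft_of_choi hΦ hX

/-- The other half of Choi's theorem: the Choi matrix is the image of an unnormalised maximally
entangled state. -/
lemma IsCompletelyPositive.posSemidef_choi [Fintype Q] [DecidableEq Q] [Fintype R]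
    {Φ : Mat Q →ₗ[ℂ] Mat R} (hΦ : IsCompletelyPositive Φ) : (choi Φ).PosSemidef := by
  let e := Fintype.equivFin Q
  let v : Q × Fin (Fintype.card Q) → ℂ := fun x => if e x.1 = x.2 then 1 else 0
  have h := (hΦ _ _ (Matrix.posSemidef_vecMulVec_self_star v)).submatrix
    fun x : Q × R => (x.2, e x.1)
  convert h using 1
  ext x y
  refine congrArg (fun M => Φ M x.2 y.2) ?_
  ext q q'
  rw [Matrix.single_apply]
  simp only [v, Matrix.of_apply, Matrix.vecMulVec_apply, Pi.star_apply, e.apply_eq_iff_eq,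
    @eq_comm _ q, @eq_comm _ q']
  by_cases h1 : x.1 = q <;> by_cases h2 : y.1 = q' <;> simp [h1, h2]

lemma IsCompletelyPositive.onLeft_posSemidef [Fintype Q] [Fintype R] [Fintype S]
    {Φ : Mat Q →ₗ[ℂ] Mat R} (hΦ : IsCompletelyPositive Φ) {X : Mat (Q × S)} (hX : X.PosSemidef) :
    (onLeft S Φ X).PosSemidef := by
  classical
  exact posSemidef_onLeft_of_choi hΦ.posSemidef_choi hX

lemma IsCompletelyPositive.map_posSemidef [Fintype Q] [Fintype R]
    {Φ : Mat Q →ₗ[ℂ] Mat R} (hΦ : IsCompletelyPositive Φ) {X : Mat Q} (hX : X.PosSemidef) :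
    (Φ X).PosSemidef :=
  (hΦ 1 _ (hX.submatrix Prod.fst)).submatrix fun r : R => (r, (0 : Fin 1))

lemma IsCompletelyPositive.comp {Φ : Mat R →ₗ[ℂ] Mat T} {Ψ : Mat Q →ₗ[ℂ] Mat R}
    (hΦ : IsCompletelyPositive Φ) (hΨ : IsCompletelyPositive Ψ) :
    IsCompletelyPositive (Φ ∘ₗ Ψ) :=
  fun n X hX => hΦ n _ (hΨ n X hX)

lemma isCompletelyPositive_relabel (e : Q ≃ R) : IsCompletelyPositive (relabel e) :=
  fun n _ hX => hX.submatrix fun x : R × Fin n => (e.symm x.1, x.2)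

lemma isCompletelyPositive_id : IsCompletelyPositive (LinearMap.id : Mat Q →ₗ[ℂ] Mat Q) :=
  fun _ _ hX => hX

lemma IsCompletelyPositive.onLeft [Fintype Q] [Fintype R] [Fintype S]
    {Φ : Mat Q →ₗ[ℂ] Mat R} (hΦ : IsCompletelyPositive Φ) :
    IsCompletelyPositive (onLeft S Φ) := fun n _ hX =>
  (hΦ.onLeft_posSemidef (S := S × Fin n)
    (hX.submatrix fun x : Q × (S × Fin n) => ((x.1, x.2.1), x.2.2))).submatrix
      fun x : (R × S) × Fin n => (x.1.1, (x.1.2, x.2))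

lemma IsCompletelyPositive.onRight [Fintype Q] [Fintype R] [Fintype S]
    {Φ : Mat Q →ₗ[ℂ] Mat R} (hΦ : IsCompletelyPositive Φ) :
    IsCompletelyPositive (onRight S Φ) := fun n _ hX =>
  (hΦ.onLeft_posSemidef (S := S × Fin n)
    (hX.submatrix fun x : Q × (S × Fin n) => ((x.2.1, x.1), x.2.2))).submatrix
      fun x : (S × R) × Fin n => (x.1.2, (x.1.1, x.2))

lemma isOperation_id [Fintype Q] : IsOperation (LinearMap.id : Mat Q →ₗ[ℂ] Mat Q) :=
  ⟨isCompletelyPositive_id, fun _ => rfl⟩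

/-- A positive semidefinite operator on (input) ⊗ (output) whose output marginal is the identity is
the Choi matrix of an operation. -/
lemma isOperation_ofChoi [Fintype Q] [DecidableEq Q] [Fintype R] {C : Mat (Q × R)}
    (hC : C.PosSemidef) (htr : ∀ q q', ∑ r, C (q, r) (q', r) = if q = q' then 1 else 0) :
    IsOperation (ofChoi C) := by
  refine ⟨isCompletelyPositive_of_choi (by rwa [choi_ofChoi]), fun X => ?_⟩
  simp only [Matrix.trace, Matrix.diag_apply, ofChoi_apply]
  rw [Finset.sum_comm]
  refine Finset.sum_congr rfl fun q _ => ?_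
  rw [Finset.sum_comm]
  simp [← Finset.mul_sum, htr]

lemma IsOperation.sum_apply [Fintype Q] [Fintype R] {Φ : Mat Q →ₗ[ℂ] Mat R} (hΦ : IsOperation Φ)
    (X : Mat Q) : ∑ r, Φ X r r = ∑ q, X q q :=
  hΦ.tracePreserving X

end Choi

/-! ### The entangled projector and the flip -/

/-- The operator `∑ |i i⟩⟨j j|`, which is `K` times the projector onto the maximally entangled
vector. -/
def entOp (K : ℕ) : Mat (Fin K × Fin K) :=
  Matrix.of fun x y => (if x.1 = x.2 then 1 else 0) * (if y.1 = y.2 then 1 else 0)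

/-- The flip `|i j⟩ ↦ |j i⟩`, which is the partial transpose of `entOp`. -/
def flipOp (K : ℕ) : Mat (Fin K × Fin K) :=
  Matrix.of fun x y => (if x.1 = y.2 then 1 else 0) * (if y.1 = x.2 then 1 else 0)

lemma posSemidef_entOp (K : ℕ) : (entOp K).PosSemidef := by
  convert Matrix.posSemidef_vecMulVec_self_star
    (fun x : Fin K × Fin K => if x.1 = x.2 then (1 : ℂ) else 0) using 1
  ext x y
  simp [entOp, Matrix.vecMulVec_apply]

lemma entOp_mul_self (K : ℕ) : entOp K * entOp K = (K : ℂ) • entOp K := by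
  ext x y
  simp [entOp, Matrix.mul_apply, Fintype.sum_prod_type]

lemma flipOp_mul_self (K : ℕ) : flipOp K * flipOp K = 1 := by
  ext x y
  simp [flipOp, Matrix.mul_apply, Fintype.sum_prod_type, Matrix.one_apply, Prod.ext_iff]
  grind

lemma isHermitian_flipOp (K : ℕ) : (flipOp K).IsHermitian := by
  ext x y
  simp [flipOp, Matrix.conjTranspose_apply]
  grind

/-- Up to the factor `K`, this is a projector: `(K - ω)² = K (K - ω)` because
`ω² = K ω`, with `ω = entOp K`. -/
lemma posSemidef_sub_entOp {K : ℕ} (hK : 1 ≤ K) : ((K : ℂ) • 1 - entOp K).PosSemidef := by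
  have hK0 : (K : ℂ) ≠ 0 := by exact_mod_cast (by omega : K ≠ 0)
  have h := (Matrix.posSemidef_conjTranspose_mul_self ((K : ℂ) • 1 - entOp K)).smul
    (a := (K : ℂ)⁻¹) (by positivity)
  convert h using 1
  rw [Matrix.conjTranspose_sub, Matrix.conjTranspose_smul, (posSemidef_entOp K).isHermitian.eq]
  simp only [Matrix.conjTranspose_one, star_natCast, sub_mul, mul_sub, entOp_mul_self,
    Matrix.smul_mul, Matrix.mul_smul, one_mul, mul_one, sub_self, sub_zero, ← smul_sub]
  rw [smul_smul, inv_mul_cancel₀ hK0, one_smul]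

lemma posSemidef_one_add_flipOp (K : ℕ) : (1 + flipOp K).PosSemidef := by
  have h := (Matrix.posSemidef_conjTranspose_mul_self (1 + flipOp K)).smul
    (a := (2 : ℂ)⁻¹) (by positivity)
  convert h using 1
  rw [Matrix.conjTranspose_add, (isHermitian_flipOp K).eq, Matrix.conjTranspose_one]
  simp only [add_mul, mul_add, flipOp_mul_self, one_mul, mul_one]
  rw [add_comm (flipOp K) 1, ← two_smul ℂ (1 + flipOp K), smul_smul]
  norm_num

lemma posSemidef_one_sub_flipOp (K : ℕ) : (1 - flipOp K).PosSemidef := by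
  have h := (Matrix.posSemidef_conjTranspose_mul_self (1 - flipOp K)).smul
    (a := (2 : ℂ)⁻¹) (by positivity)
  convert h using 1
  rw [Matrix.conjTranspose_sub, (isHermitian_flipOp K).eq, Matrix.conjTranspose_one]
  simp only [sub_mul, mul_sub, flipOp_mul_self, one_mul, mul_one]
  rw [show (1 - flipOp K - (flipOp K - 1)) = (2 : ℂ) • (1 - flipOp K) by
    rw [two_smul]; abel, smul_smul]
  norm_num

lemma channelFidelity_eq {K : ℕ} (M : Mat (Fin K) →ₗ[ℂ] Mat (Fin K)) :
    channelFidelity M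
      = (((K : ℂ) ^ 2)⁻¹ * ∑ c, ∑ a, M (Matrix.single c a 1) c a).re := by
  have hφ : maxEnt K = (K : ℂ)⁻¹ • entOp K := by
    ext x y
    have h : (((Real.sqrt K)⁻¹ : ℝ) : ℂ) * (((Real.sqrt K)⁻¹ : ℝ) : ℂ) = (K : ℂ)⁻¹ := by
      rw [← Complex.ofReal_mul, ← mul_inv, Real.mul_self_sqrt (Nat.cast_nonneg K)]
      simp
    simp only [maxEnt, maxEntVec, entOp, Matrix.vecMulVec_apply, Pi.star_apply, Matrix.smul_apply,
      Matrix.of_apply, smul_eq_mul]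
    rw [← h]
    split_ifs <;> simp
  have hω : ∀ s s' : Fin K, (Matrix.of fun q q' => entOp K (q, s) (q', s') : Mat (Fin K))
      = Matrix.single s s' 1 := by
    intro s s'
    ext q q'
    rw [Matrix.single_apply]
    simp only [entOp, Matrix.of_apply, @eq_comm _ s, @eq_comm _ s']
    by_cases h1 : q = s <;> by_cases h2 : q' = s' <;> simp [h1, h2]
  unfold channelFidelity
  congr 1
  rw [hφ, map_smul, Matrix.smul_mul, Matrix.mul_smul, smul_smul, Matrix.trace_smul, smul_eq_mul,
    ← mul_inv, ← sq]
  congr 1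
  simp only [Matrix.trace, Matrix.diag_apply, Matrix.mul_apply, Fintype.sum_prod_type]
  have hl : ∀ c s a s', onLeft (Fin K) M (entOp K) (c, s) (a, s')
      = M (Matrix.single s s' 1) c a := by
    intro c s a s'
    rw [← hω]; rfl
  simp only [hl]
  simp [entOp]
  rw [Finset.sum_comm]

/-! ### Bipartite operations and the contraction of their Choi matrices -/

section Bipartite

variable {K : ℕ} {A' B : Type*}

/-- The Choi matrix of a bipartite map `A B → A' B'`, regrouped as an operator on
`(A B') (A' B)`. -/
def bipartiteChoi [DecidableEq B] (Z : Mat (Fin K × B) →ₗ[ℂ] Mat (A' × Fin K)) :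
    Mat ((Fin K × Fin K) × (A' × B)) :=
  (choi Z).submatrix (fun x => ((x.1.1, x.2.2), (x.2.1, x.1.2)))
    (fun x => ((x.1.1, x.2.2), (x.2.1, x.1.2)))

lemma bipartiteChoi_apply [DecidableEq B] (Z : Mat (Fin K × B) →ₗ[ℂ] Mat (A' × Fin K))
    (c k a k' : Fin K) (p p' : A') (b b' : B) :
    bipartiteChoi Z ((c, k), (p, b)) ((a, k'), (p', b'))
      = Z (Matrix.single (c, b) (a, b') 1) (p, k) (p', k') := rfl

lemma traceLeft_single {P Q : Type*} [Fintype P] [DecidableEq P] [DecidableEq Q] (c a : P)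
    (b b' : Q) : traceLeft (Matrix.single (c, b) (a, b') (1 : ℂ))
      = if c = a then Matrix.single b b' 1 else 0 := by
  ext b₁ b₁'
  simp only [traceLeft, Matrix.of_apply, Matrix.single_apply, Prod.ext_iff]
  by_cases hca : c = a
  · subst hca
    by_cases h1 : b = b₁ <;> by_cases h2 : b' = b₁' <;> simp [h1, h2]
  · rw [if_neg hca]
    refine Finset.sum_eq_zero fun x _ => if_neg ?_
    rintro ⟨⟨rfl, -⟩, rfl, -⟩
    exact hca rfl

/-- A bipartite map conjugated with the partial transposition of Bob's systems. -/
def partialTransposeMap {A B A' B' : Type*} (Z : Mat (A × B) →ₗ[ℂ] Mat (A' × B')) :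
    Mat (A × B) →ₗ[ℂ] Mat (A' × B') where
  toFun X := transposeRight (Z (transposeRight X))
  map_add' X Y := by
    rw [show transposeRight (X + Y) = transposeRight X + transposeRight Y from rfl, map_add]
    rfl
  map_smul' c X := by
    rw [show transposeRight (c • X) = c • transposeRight X from rfl, map_smul]
    rfl

lemma transposeRight_single {P Q : Type*} [DecidableEq P] [DecidableEq Q] (x y : P × Q) :
    transposeRight (Matrix.single x y (1 : ℂ)) = Matrix.single (x.1, y.2) (y.1, x.2) 1 := by
  ext u v
  simp only [transposeRight, Matrix.of_apply, Matrix.single_apply, Prod.ext_iff]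
  congr 1
  simp only [eq_iff_iff]
  tauto

lemma transposeRight_kronecker_one {P Q : Type*} [DecidableEq Q] (X : Mat P) :
    transposeRight (X ⊗ₖ (1 : Mat Q)) = X ⊗ₖ (1 : Mat Q) := by
  ext x y
  simp [transposeRight, Matrix.kroneckerMap_apply, Matrix.one_apply, eq_comm]

lemma bipartiteChoi_partialTransposeMap_apply [DecidableEq B]
    (Z : Mat (Fin K × B) →ₗ[ℂ] Mat (A' × Fin K)) (c k a k' : Fin K) (p p' : A') (b b' : B) :
    bipartiteChoi (partialTransposeMap Z) ((c, k), (p, b)) ((a, k'), (p', b'))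
      = Z (Matrix.single (c, b') (a, b) 1) (p, k') (p', k) := by
  rw [bipartiteChoi_apply]
  change Z (transposeRight _) _ _ = _
  rw [transposeRight_single]

lemma contractLeft_entOp_bipartiteChoi [DecidableEq B]
    (Z : Mat (Fin K × B) →ₗ[ℂ] Mat (A' × Fin K)) (p p' : A') (b b' : B) :
    contractLeft (entOp K) (bipartiteChoi Z) (p, b) (p', b')
      = ∑ c, ∑ a, Z (Matrix.single (c, b) (a, b') 1) (p, c) (p', a) := by
  simp only [contractLeft_apply, Fintype.sum_prod_type, bipartiteChoi_apply, entOp,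
    Matrix.of_apply]
  simp

/-- Partial transposition of Bob's systems exchanges `entOp` and `flipOp` in the contraction. -/
lemma contractLeft_flipOp_bipartiteChoi [DecidableEq B]
    (Z : Mat (Fin K × B) →ₗ[ℂ] Mat (A' × Fin K)) :
    contractLeft (flipOp K) (bipartiteChoi (partialTransposeMap Z))
      = transposeRight (contractLeft (entOp K) (bipartiteChoi Z)) := by
  ext ⟨p, b⟩ ⟨p', b'⟩
  change _ = contractLeft (entOp K) (bipartiteChoi Z) (p, b') (p', b)
  rw [contractLeft_entOp_bipartiteChoi]
  simp only [contractLeft_apply, Fintype.sum_prod_type, bipartiteChoi_partialTransposeMap_apply,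
    flipOp, Matrix.of_apply]
  simp

lemma contractLeft_one_bipartiteChoi_partialTransposeMap [DecidableEq B]
    (Z : Mat (Fin K × B) →ₗ[ℂ] Mat (A' × Fin K)) :
    contractLeft 1 (bipartiteChoi (partialTransposeMap Z))
      = transposeRight (contractLeft 1 (bipartiteChoi Z)) := by
  ext ⟨p, b⟩ ⟨p', b'⟩
  change _ = contractLeft 1 (bipartiteChoi Z) (p, b') (p', b)
  simp only [contractLeft_one, Fintype.sum_prod_type, bipartiteChoi_partialTransposeMap_apply]
  rfl

lemma posSemidef_bipartiteChoi_iff [DecidableEq B]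
    (Z : Mat (Fin K × B) →ₗ[ℂ] Mat (A' × Fin K)) :
    (bipartiteChoi Z).PosSemidef ↔ (choi Z).PosSemidef :=
  ⟨fun h => h.submatrix fun x : (Fin K × B) × (A' × Fin K) => ((x.1.1, x.2.2), (x.2.1, x.1.2)),
    fun h => h.submatrix _⟩

/-- Partial transposition of Bob's systems before and after turns `Z` into `partialTransposeMap Z`,
with any ancillas. -/
lemma transposeRight_applyWithAncillas {A B A' B' : Type*} (s t : Type*)
    (Z : Mat (A × B) →ₗ[ℂ] Mat (A' × B')) (σ : Mat ((A × s) × (B × t))) :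
    transposeRight (applyWithAncillas s t Z σ)
      = applyWithAncillas s t (partialTransposeMap Z) (transposeRight σ) := rfl

/-- A bipartite map is PPT-preserving as soon as its conjugate by the partial transposition has a
positive semidefinite Choi matrix. -/
lemma pptPreserving_of_choi {A B A' B' : Type*} [Fintype A] [Fintype B] [Fintype A'] [Fintype B']
    [DecidableEq A] [DecidableEq B] {Z : Mat (A × B) →ₗ[ℂ] Mat (A' × B')}
    (h : (choi (partialTransposeMap Z)).PosSemidef) : PPTPreserving Z := by
  intro m n σ _ hσ
  rw [transposeRight_applyWithAncillas]
  exact (posSemidef_onLeft_of_choi (S := Fin m × Fin n) h (hσ.submatrix _)).submatrix _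

/-- Conversely, the state that is maximally entangled between `A`, `B` and their ancillas is its own
partial transpose, and it is mapped to the Choi matrix. -/
lemma PPTPreserving.posSemidef_choi {A B A' B' : Type*} [Fintype A] [Fintype B] [Fintype A']
    [Fintype B'] [DecidableEq A] [DecidableEq B] [Nonempty A] [Nonempty B]
    {Z : Mat (A × B) →ₗ[ℂ] Mat (A' × B')} (hZ : PPTPreserving Z) :
    (choi (partialTransposeMap Z)).PosSemidef := by
  let e := Fintype.equivFin A
  let f := Fintype.equivFin B
  let v : (A × Fin (Fintype.card A)) × (B × Fin (Fintype.card B)) → ℂ :=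
    fun x => (if e x.1.1 = x.1.2 then 1 else 0) * (if f x.2.1 = x.2.2 then 1 else 0)
  let d : ℂ := (Fintype.card A : ℂ) * Fintype.card B
  have hd : d ≠ 0 := mul_ne_zero (by simp) (by simp)
  have hd0 : 0 ≤ d⁻¹ := by positivity
  let σ : Mat ((A × Fin (Fintype.card A)) × (B × Fin (Fintype.card B))) :=
    d⁻¹ • Matrix.vecMulVec v (star v)
  have hσ : σ.PosSemidef := (Matrix.posSemidef_vecMulVec_self_star v).smul hd0
  have htr : σ.trace = 1 := by
    have hv : (Matrix.vecMulVec v (star v)).trace = d := by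
      rw [Matrix.trace_vecMulVec]
      simp [v, d, dotProduct, Fintype.sum_prod_type]
    rw [Matrix.trace_smul, hv, smul_eq_mul, inv_mul_cancel₀ hd]
  have htσ : transposeRight σ = σ := by
    ext x y
    simp only [transposeRight, σ, v, Matrix.of_apply, Matrix.smul_apply, Matrix.vecMulVec_apply,
      Pi.star_apply, star_mul', RCLike.star_def, MonoidWithZeroHom.map_ite_one_zero, smul_eq_mul]
    ring
  have h := ((hZ _ _ σ ⟨hσ, htr⟩ (by rwa [htσ])).submatrix
    fun x : (A × B) × (A' × B') => ((x.2.1, e x.1.1), (x.2.2, f x.1.2))).smul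
      (a := d) (by positivity)
  rw [transposeRight_applyWithAncillas, htσ] at h
  convert h using 1
  ext x y
  have hs : (Matrix.of fun q q' : A × B => σ ((q.1, e x.1.1), (q.2, f x.1.2))
        ((q'.1, e y.1.1), (q'.2, f y.1.2)) : Mat (A × B))
      = d⁻¹ • Matrix.single x.1 y.1 1 := by
    ext q q'
    simp only [σ, v, Matrix.of_apply, Matrix.smul_apply, Matrix.vecMulVec_apply, Pi.star_apply,
      Matrix.single_apply, Prod.ext_iff, e.apply_eq_iff_eq, f.apply_eq_iff_eq, smul_eq_mul]
    congr 1
    simp only [@eq_comm _ x.1.1, @eq_comm _ x.1.2, @eq_comm _ y.1.1, @eq_comm _ y.1.2]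
    by_cases h1 : q.1 = x.1.1 <;> by_cases h2 : q.2 = x.1.2 <;> simp [h1, h2]
    by_cases h3 : q'.1 = y.1.1 <;> by_cases h4 : q'.2 = y.1.2 <;> simp [h3, h4]
  change _ = d * partialTransposeMap Z (Matrix.of fun q q' : A × B =>
    σ ((q.1, e x.1.1), (q.2, f x.1.2)) ((q'.1, e y.1.1), (q'.2, f y.1.2))) x.2 y.2
  rw [hs, map_smul, Matrix.smul_apply, smul_eq_mul, mul_inv_cancel_left₀ hd]
  rfl

end Bipartite

/-! ### From codes to feasible points -/

namespace ForwardCode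

variable {K : ℕ} {A' B : Type*} [Fintype A'] [Fintype B] (C : ForwardCode K A' B)

lemma isCompletelyPositive_bipartite : IsCompletelyPositive C.bipartite :=
  C.dec_isOperation.completelyPositive.onRight.comp
    (C.side_isOperation.completelyPositive.onRight.onRight.comp
      ((isCompletelyPositive_relabel _).comp C.enc_isOperation.completelyPositive.onLeft))

/-- Alice's marginal output does not depend on Bob's input. -/
lemma sum_bipartite (X : Mat (Fin K × B)) (p p' : A') :
    ∑ k, C.bipartite X (p, k) (p', k)
      = ∑ b, ∑ q, C.enc (Matrix.of fun a a' => X (a, b) (a', b)) (p, q) (p', q) := by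
  change ∑ k, C.dec (Matrix.of fun x x' => onRight B C.side (Matrix.of fun y y' =>
    onLeft B C.enc X ((p, y.2), y.1) ((p', y'.2), y'.1)) x x') k k = _
  rw [C.dec_isOperation.sum_apply, Fintype.sum_prod_type]
  refine Finset.sum_congr rfl fun b _ => ?_
  change ∑ s, C.side (Matrix.of fun q q' => onLeft B C.enc X ((p, q), b) ((p', q'), b)) s s = _
  rw [C.side_isOperation.sum_apply]
  rfl

/-- The average state of the channel input, when the input of the code is maximally mixed. -/
def inputState : Mat A' :=
  (K : ℂ)⁻¹ • Matrix.of fun p p' => ∑ q, C.enc 1 (p, q) (p', q)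

/-- The operator `Λ` of a code: the contraction of the Choi matrix of its bipartite operation with
the maximally entangled projector. -/
def lamOp [DecidableEq B] : Mat (A' × B) :=
  ((K : ℂ) ^ 2)⁻¹ • contractLeft (entOp K) (bipartiteChoi C.bipartite)

lemma posSemidef_inputState : C.inputState.PosSemidef := by
  have h1 : (C.enc 1).PosSemidef := C.enc_isOperation.completelyPositive.map_posSemidef .one
  have h := posSemidef_contractLeft (X := (1 : Mat (Fin C.q))) .one
    (h1.submatrix fun x : Fin C.q × A' => (x.2, x.1))
  have h2 := h.smul (a := (K : ℂ)⁻¹) (by positivity)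
  convert h2 using 1
  ext p p'
  simp [inputState, contractLeft_one]

lemma trace_inputState (hK : 1 ≤ K) : C.inputState.trace = 1 := by
  have hK0 : (K : ℂ) ≠ 0 := by exact_mod_cast (by omega : K ≠ 0)
  have h := C.enc_isOperation.sum_apply 1
  rw [Fintype.sum_prod_type] at h
  rw [inputState, Matrix.trace_smul]
  change (K : ℂ)⁻¹ • ∑ p, ∑ q, C.enc 1 (p, q) (p, q) = 1
  rw [h]
  simp [hK0]

/-- Because Alice's output does not depend on Bob's input, the contraction of the Choi matrix with
the identity factorises over `A'` and `B`. -/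
lemma inputState_kronecker_one [DecidableEq B] :
    C.inputState ⊗ₖ (1 : Mat B)
      = (K : ℂ)⁻¹ • contractLeft 1 (bipartiteChoi C.bipartite) := by
  ext ⟨p, b⟩ ⟨p', b'⟩
  have hs : ∀ c b₁, (Matrix.of fun a a' => Matrix.single (c, b) (c, b') (1 : ℂ) (a, b₁) (a', b₁) :
      Mat (Fin K)) = if b = b₁ ∧ b' = b₁ then Matrix.single c c 1 else 0 := by
    intro c b₁
    ext a a'
    by_cases h1 : b = b₁ <;> by_cases h2 : b' = b₁ <;>
      simp [h1, h2, Matrix.single_apply]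
  have h1 : (1 : Mat (Fin K)) = ∑ c, Matrix.single c c 1 := by
    rw [Matrix.sum_single_eq_diagonal]; rfl
  simp only [Matrix.kroneckerMap_apply, Matrix.smul_apply, contractLeft_one,
    Fintype.sum_prod_type, bipartiteChoi_apply, sum_bipartite, hs, inputState, Matrix.of_apply,
    smul_eq_mul, mul_assoc]
  congr 1
  rw [h1, map_sum]
  simp only [Matrix.sum_apply]
  rw [Finset.sum_comm, Finset.sum_mul]
  refine Finset.sum_congr rfl fun c _ => ?_
  by_cases hb : b = b'
  · subst hb
    rw [Finset.sum_eq_single b]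
    · simp
    · intro b₁ _ hb₁
      simp [hb₁.symm]
    · simp
  · rw [Matrix.one_apply_ne hb, mul_zero]
    refine (Finset.sum_eq_zero fun b₁ _ => ?_).symm
    rw [if_neg]
    · simp
    · rintro ⟨rfl, rfl⟩
      exact hb rfl

section

variable [DecidableEq B]

lemma posSemidef_bipartiteChoi : (bipartiteChoi C.bipartite).PosSemidef :=
  (posSemidef_bipartiteChoi_iff _).2 C.isCompletelyPositive_bipartite.posSemidef_choi

lemma posSemidef_lamOp : C.lamOp.PosSemidef :=
  (posSemidef_contractLeft (posSemidef_entOp K) C.posSemidef_bipartiteChoi).smul (by positivity)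

lemma posSemidef_inputState_sub_lamOp (hK : 1 ≤ K) :
    (C.inputState ⊗ₖ (1 : Mat B) - C.lamOp).PosSemidef := by
  have hK0 : (K : ℂ) ≠ 0 := by exact_mod_cast (by omega : K ≠ 0)
  have h := (posSemidef_contractLeft (posSemidef_sub_entOp hK) C.posSemidef_bipartiteChoi).smul
    (a := ((K : ℂ) ^ 2)⁻¹) (by positivity)
  convert h using 1
  rw [C.inputState_kronecker_one, lamOp, contractLeft_sub, contractLeft_smul, smul_sub,
    smul_smul]
  congr 2
  field_simp

lemma traceLeft_lamOp (hC : NonSignallingAliceToBob C.bipartite) :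
    traceLeft C.lamOp = ((K : ℂ) ^ 2)⁻¹ • (1 : Mat B) := by
  obtain ⟨ZB, hZB, hZ⟩ := hC
  ext b b'
  have h1 : ∀ c a : Fin K, ∑ p, C.bipartite (Matrix.single (c, b) (a, b') 1) (p, c) (p, a)
      = if c = a then ZB (Matrix.single b b' 1) c c else 0 := by
    intro c a
    have := congrFun (congrFun (hZ (Matrix.single (c, b) (a, b') 1)) c) a
    rw [traceLeft_single] at this
    refine this.trans ?_
    split_ifs with h
    · rw [h]
    · simp
  change ∑ p, C.lamOp (p, b) (p, b') = _
  simp only [lamOp, Matrix.smul_apply, contractLeft_entOp_bipartiteChoi, ← Finset.smul_sum]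
  congr 1
  rw [Finset.sum_comm]
  simp_rw [Finset.sum_comm (s := (Finset.univ : Finset A')), h1]
  simp only [Finset.sum_ite_eq, Finset.mem_univ, if_true]
  rw [hZB.sum_apply]
  change (Matrix.single b b' (1 : ℂ)).trace = _
  by_cases h : b = b'
  · subst h; simp
  · rw [Matrix.trace_single_eq_of_ne _ _ _ h, Matrix.one_apply_ne h]

/-- The PPT constraints, from contracting the partially transposed Choi matrix with `1 ± flipOp`. -/
lemma posSemidef_transposeRight_lamOp [Nonempty B] (hC : PPTPreserving C.bipartite) (hK : 1 ≤ K) :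
    (transposeRight C.lamOp - (-((K : ℂ)⁻¹ • (C.inputState ⊗ₖ (1 : Mat B))))).PosSemidef ∧
      ((K : ℂ)⁻¹ • (C.inputState ⊗ₖ (1 : Mat B)) - transposeRight C.lamOp).PosSemidef := by
  have hK0 : (K : ℂ) ≠ 0 := by exact_mod_cast (by omega : K ≠ 0)
  have : Nonempty (Fin K) := ⟨⟨0, hK⟩⟩
  have hW := (posSemidef_bipartiteChoi_iff _).2 hC.posSemidef_choi
  have hρ : (K : ℂ)⁻¹ • (C.inputState ⊗ₖ (1 : Mat B))
      = ((K : ℂ) ^ 2)⁻¹ • contractLeft 1 (bipartiteChoi (partialTransposeMap C.bipartite)) := by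
    rw [contractLeft_one_bipartiteChoi_partialTransposeMap,
      ← transposeRight_kronecker_one, C.inputState_kronecker_one,
      show ∀ (c : ℂ) (X : Mat (A' × B)), transposeRight (c • X) = c • transposeRight X from
        fun _ _ => rfl, smul_smul]
    congr 1
    field_simp
  have hΛ : transposeRight C.lamOp = ((K : ℂ) ^ 2)⁻¹ •
      contractLeft (flipOp K) (bipartiteChoi (partialTransposeMap C.bipartite)) := by
    rw [contractLeft_flipOp_bipartiteChoi]
    rfl
  rw [hρ, hΛ, sub_neg_eq_add, ← smul_add, ← smul_sub, ← contractLeft_sub, add_comm,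
    ← contractLeft_add]
  exact ⟨(posSemidef_contractLeft (posSemidef_one_add_flipOp K) hW).smul (by positivity),
    (posSemidef_contractLeft (posSemidef_one_sub_flipOp K) hW).smul (by positivity)⟩

/-- The bipartite operation of a code on product inputs, one factor of which is a matrix unit. -/
lemma bipartite_single (c a : Fin K) (b b' : B) (p p' : A') (k k' : Fin K) :
    C.bipartite (Matrix.single (c, b) (a, b') 1) (p, k) (p', k')
      = (C.dec ∘ₗ onRight B C.side) (Matrix.single b b' 1 ⊗ₖ
          (Matrix.of fun q q' => C.enc (Matrix.single c a 1) (p, q) (p', q'))) k k' := by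
  change C.dec (onRight B C.side (Matrix.of fun y y' =>
    onLeft B C.enc (Matrix.single (c, b) (a, b') 1) ((p, y.2), y.1) ((p', y'.2), y'.1))) k k' = _
  refine congrArg (fun M => C.dec (onRight B C.side M) k k') ?_
  ext y y'
  change C.enc (Matrix.of fun a₁ a₁' => Matrix.single (c, b) (a, b') (1 : ℂ) (a₁, y.1) (a₁', y'.1))
    (p, y.2) (p', y'.2) = _
  have hs : (Matrix.of fun a₁ a₁' => Matrix.single (c, b) (a, b') (1 : ℂ) (a₁, y.1) (a₁', y'.1) :
      Mat (Fin K)) = Matrix.single b b' (1 : ℂ) y.1 y'.1 • Matrix.single c a 1 := by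
    ext a₁ a₁'
    by_cases h1 : b = y.1 <;> by_cases h2 : b' = y'.1 <;>
      simp [h1, h2, Matrix.single_apply]
  rw [hs, map_smul]
  rfl

/-- The channel only enters the fidelity through the pairing of its Choi matrix with `lamOp`. -/
lemma channelFidelity_overall [DecidableEq A'] (N : Mat A' →ₗ[ℂ] Mat B) :
    channelFidelity (C.overall N) = ((choi N).transpose * C.lamOp).trace.re := by
  have hN : ∀ Y : Mat (A' × Fin C.q), onLeft (Fin C.q) N Y
      = ∑ x : A' × B, ∑ y : A' × B, choi N x y •
          (Matrix.single x.2 y.2 (1 : ℂ) ⊗ₖ (Matrix.of fun q q' => Y (x.1, q) (y.1, q'))) := by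
    intro Y
    ext ⟨b, q⟩ ⟨b', q'⟩
    change N (Matrix.of fun p p' => Y (p, q) (p', q')) b b' = _
    rw [apply_eq_sum_choi]
    simp only [Matrix.sum_apply, Matrix.smul_apply, Matrix.kroneckerMap_apply, Matrix.of_apply,
      smul_eq_mul, Fintype.sum_prod_type]
    refine Finset.sum_congr rfl fun p _ => ?_
    rw [Finset.sum_eq_single b]
    · refine Finset.sum_congr rfl fun p' _ => ?_
      rw [Finset.sum_eq_single b']
      · simp [mul_comm]
      · intro x _ hx
        simp [hx]
      · simp
    · intro x _ hx
      simp [hx]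
    · simp
  have hM : ∀ c a k k', C.overall N (Matrix.single c a 1) k k'
      = ∑ x : A' × B, ∑ y : A' × B, choi N x y *
        C.bipartite (Matrix.single (c, x.2) (a, y.2) 1) (x.1, k) (y.1, k') := by
    intro c a k k'
    change (C.dec ∘ₗ onRight B C.side) (onLeft (Fin C.q) N (C.enc (Matrix.single c a 1))) k k' = _
    rw [hN]
    simp only [map_sum, map_smul, Matrix.sum_apply, Matrix.smul_apply, smul_eq_mul,
      bipartite_single]
  have hΛ : ∀ x y, C.lamOp x y = ((K : ℂ) ^ 2)⁻¹ *
      ∑ c, ∑ a, C.bipartite (Matrix.single (c, x.2) (a, y.2) 1) (x.1, c) (y.1, a) := by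
    intro x y
    rw [← contractLeft_entOp_bipartiteChoi]
    rfl
  rw [channelFidelity_eq]
  congr 1
  simp only [hM, Matrix.trace, Matrix.diag_apply, Matrix.mul_apply, Matrix.transpose_apply, hΛ]
  rw [Finset.sum_comm (s := (Finset.univ : Finset (A' × B)))]
  simp_rw [Finset.sum_comm (s := (Finset.univ : Finset (Fin K)))
    (t := (Finset.univ : Finset (A' × B))), mul_left_comm _ (((K : ℂ) ^ 2)⁻¹), ← Finset.mul_sum]

end

end ForwardCode

/-! ### From feasible points to codes -/

section Effect

open scoped MatrixOrder

variable {A' B : Type*} [Fintype A'] [Fintype B] [DecidableEq A'] [DecidableEq B]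

/-- A square root of a positive semidefinite operator together with its pseudo-inverse, both read
off from a spectral decomposition. -/
lemma exists_factor_pseudoInverse {ρ : Mat A'} (hρ : ρ.PosSemidef) :
    ∃ S R : Mat A', S * S.conjTranspose = ρ ∧ (1 - R * ρ * R.conjTranspose).PosSemidef ∧
      S * R * ρ = ρ := by
  let U : Mat A' := hρ.isHermitian.eigenvectorUnitary
  let d : A' → ℝ := hρ.isHermitian.eigenvalues
  have hd : ∀ i, 0 ≤ d i := hρ.eigenvalues_nonneg
  have hU : U.conjTranspose * U = 1 :=
    Unitary.coe_star_mul_self hρ.isHermitian.eigenvectorUnitary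
  have hU' : ∀ M : Mat A', U.conjTranspose * (U * M) = M := fun M => by
    rw [← Matrix.mul_assoc, hU, Matrix.one_mul]
  have hsp : ρ = U * (Matrix.diagonal (fun i => (d i : ℂ)) * U.conjTranspose) := by
    have h := hρ.isHermitian.spectral_theorem
    rw [Unitary.conjStarAlgAut_apply, Matrix.mul_assoc] at h
    exact h
  have hs : ∀ i, ((Real.sqrt (d i) : ℝ) : ℂ) * ((Real.sqrt (d i) : ℝ) : ℂ) = d i := fun i => by
    rw [← Complex.ofReal_mul, Real.mul_self_sqrt (hd i)]
  let s : A' → ℂ := fun i => ((Real.sqrt (d i) : ℝ) : ℂ)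
  have hstar : star s = s := by
    ext i; simp [s]
  have hstar' : star (fun i => (s i)⁻¹) = fun i => (s i)⁻¹ := by
    ext i; simp [s]
  -- The convention `0⁻¹ = 0` makes the second factor a pseudo-inverse of the first.
  refine ⟨U * Matrix.diagonal s, Matrix.diagonal (fun i => (s i)⁻¹) * U.conjTranspose, ?_, ?_, ?_⟩
  · rw [Matrix.conjTranspose_mul, Matrix.diagonal_conjTranspose, hstar, hsp]
    simp only [Matrix.mul_assoc]
    rw [← Matrix.mul_assoc (Matrix.diagonal s), Matrix.diagonal_mul_diagonal]
    simp only [s, hs]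
  · have h : Matrix.diagonal (fun i => (s i)⁻¹) * U.conjTranspose * ρ *
        (Matrix.diagonal (fun i => (s i)⁻¹) * U.conjTranspose).conjTranspose
        = Matrix.diagonal fun i => (s i)⁻¹ * (d i * (s i)⁻¹) := by
      rw [Matrix.conjTranspose_mul, Matrix.diagonal_conjTranspose, hstar',
        Matrix.conjTranspose_conjTranspose, hsp]
      simp only [Matrix.mul_assoc, hU', Matrix.diagonal_mul_diagonal]
    rw [h, ← Matrix.diagonal_one, Matrix.diagonal_sub]
    refine Matrix.PosSemidef.diagonal fun i => ?_
    change 0 ≤ 1 - (s i)⁻¹ * (d i * (s i)⁻¹)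
    by_cases h0 : s i = 0
    · simp [h0]
    · rw [← hs i]
      change 0 ≤ 1 - (s i)⁻¹ * (s i * s i * (s i)⁻¹)
      field_simp
      simp
  · conv_lhs => rw [hsp]
    rw [hsp]
    simp only [Matrix.mul_assoc, hU']
    congr 1
    simp only [← Matrix.mul_assoc, Matrix.diagonal_mul_diagonal]
    congr 2
    funext i
    rw [← mul_assoc]
    by_cases h0 : s i = 0
    · have hd0 : (d i : ℂ) = 0 := by
        rw [← hs i]
        change s i * s i = 0
        rw [h0, mul_zero]
      rw [hd0, mul_zero]
    · rw [mul_inv_cancel₀ h0, one_mul]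

/-- If `0 ≤ Λ ≤ ρ ⊗ 1` then `Λ = (S ⊗ 1) E (S ⊗ 1)†` for a square root `S` of `ρ` and an effect
`E`: this is the measurement that a decoder holding the purification of `ρ` carries out. -/
lemma exists_effect {ρ : Mat A'} {Λ : Mat (A' × B)} (hρ : ρ.PosSemidef) (hΛ : Λ.PosSemidef)
    (hle : (ρ ⊗ₖ (1 : Mat B) - Λ).PosSemidef) :
    ∃ (S : Mat A') (E : Mat (A' × B)), S * S.conjTranspose = ρ ∧ E.PosSemidef ∧
      (1 - E).PosSemidef ∧
      (S ⊗ₖ (1 : Mat B)) * E * (S ⊗ₖ (1 : Mat B)).conjTranspose = Λ := by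
  obtain ⟨S, R, hS, hR, hSR⟩ := exists_factor_pseudoInverse hρ
  refine ⟨S, (R ⊗ₖ (1 : Mat B)) * Λ * (R ⊗ₖ (1 : Mat B)).conjTranspose, hS,
    hΛ.mul_mul_conjTranspose_same _, ?_, ?_⟩
  · have h1 := (posSemidef_kronecker hR (.one (n := B))).add
      (hle.mul_mul_conjTranspose_same (R ⊗ₖ (1 : Mat B)))
    convert h1 using 1
    have h2 : (R ⊗ₖ (1 : Mat B)) * (ρ ⊗ₖ (1 : Mat B)) * (R ⊗ₖ (1 : Mat B)).conjTranspose
        = (R * ρ * R.conjTranspose) ⊗ₖ (1 : Mat B) := by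
      rw [Matrix.conjTranspose_kronecker, ← Matrix.mul_kronecker_mul, ← Matrix.mul_kronecker_mul]
      simp
    have h3 : (1 - R * ρ * R.conjTranspose) ⊗ₖ (1 : Mat B)
        = 1 - (R * ρ * R.conjTranspose) ⊗ₖ (1 : Mat B) := by
      ext x y
      simp only [Matrix.kroneckerMap_apply, Matrix.sub_apply, sub_mul]
      congr 1
      exact congrFun (congrFun (Matrix.one_kronecker_one (α := ℂ) (m := A') (n := B)) x) y
    rw [mul_sub, sub_mul, h2, h3]
    abel
  · have hPρ : ((S * R) ⊗ₖ (1 : Mat B)) * (ρ ⊗ₖ (1 : Mat B)) = ρ ⊗ₖ (1 : Mat B) := by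
      rw [← Matrix.mul_kronecker_mul, hSR, one_mul]
    let D : Mat (A' × B) := 1 - (S * R) ⊗ₖ (1 : Mat B)
    have hD0 : D * (ρ ⊗ₖ (1 : Mat B)) = 0 := by
      rw [sub_mul, one_mul, hPρ, sub_self]
    -- `D` annihilates `ρ ⊗ 1`, hence also every operator between `0` and `ρ ⊗ 1`.
    have h1 : (D * Λ * D.conjTranspose).PosSemidef := hΛ.mul_mul_conjTranspose_same D
    have h2 : (-(D * Λ * D.conjTranspose)).PosSemidef := by
      have := hle.mul_mul_conjTranspose_same D
      rwa [mul_sub, hD0, zero_sub, neg_mul] at this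
    have h3 : D * Λ * D.conjTranspose = 0 :=
      le_antisymm (by rw [Matrix.le_iff, zero_sub]; exact h2) h1.nonneg
    obtain ⟨G, hG⟩ := CStarAlgebra.nonneg_iff_eq_star_mul_self.mp hΛ.nonneg
    rw [Matrix.star_eq_conjTranspose] at hG
    have h4 : D * G.conjTranspose = 0 := by
      rw [← Matrix.self_mul_conjTranspose_eq_zero, Matrix.conjTranspose_mul,
        Matrix.conjTranspose_conjTranspose, ← h3, hG]
      simp only [Matrix.mul_assoc]
    have h5 : ((S * R) ⊗ₖ (1 : Mat B)) * Λ = Λ := by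
      have : D * Λ = 0 := by rw [hG, ← Matrix.mul_assoc, h4, Matrix.zero_mul]
      rw [sub_mul, one_mul, sub_eq_zero] at this
      exact this.symm
    have h6 : Λ * ((S * R) ⊗ₖ (1 : Mat B)).conjTranspose = Λ := by
      have := congrArg Matrix.conjTranspose h5
      rwa [Matrix.conjTranspose_mul, hΛ.isHermitian.eq] at this
    have h7 : (S * R) ⊗ₖ (1 : Mat B) = (S ⊗ₖ (1 : Mat B)) * (R ⊗ₖ (1 : Mat B)) := by
      rw [← Matrix.mul_kronecker_mul, one_mul]
    rw [h7] at h5 h6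
    rw [Matrix.conjTranspose_mul] at h6
    calc _ = (S ⊗ₖ (1 : Mat B)) * (R ⊗ₖ (1 : Mat B)) * Λ *
          ((R ⊗ₖ (1 : Mat B)).conjTranspose * (S ⊗ₖ (1 : Mat B)).conjTranspose) := by
            simp only [Matrix.mul_assoc]
      _ = Λ := by rw [h5, h6]

end Effect

section Construction

variable {K : ℕ} {A' B : Type*} [Fintype A'] [Fintype B] [DecidableEq A'] [DecidableEq B]

/-- The Choi matrix of the encoder that appends the purification `∑ S_{p p'} |p⟩|p'⟩` of
`ρ = S S†`, sends its first half into the channel and forwards the second half with the message. -/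
def purifyingEncoder {q : ℕ} (e : Fin q ≃ A' × Fin K) (S : Mat A') :
    Mat (Fin K × (A' × Fin q)) :=
  Matrix.vecMulVec (fun x => S x.2.1 (e x.2.2).1 * if (e x.2.2).2 = x.1 then 1 else 0)
    (star fun x => S x.2.1 (e x.2.2).1 * if (e x.2.2).2 = x.1 then 1 else 0)

/-- The Choi matrix of the decoder that measures the effect `E` on the channel output and the
purification; on success it outputs the message, on failure it applies to the message the channel
with Choi matrix `t (K 1 - entOp K)`. -/
def measuringDecoder {q : ℕ} (e : Fin q ≃ A' × Fin K) (E : Mat (A' × B)) (t : ℂ) :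
    Mat ((B × Fin q) × Fin K) :=
  (E ⊗ₖ entOp K + t • ((1 - E) ⊗ₖ ((K : ℂ) • 1 - entOp K))).submatrix
    (fun x => (((e x.1.2).1, x.1.1), ((e x.1.2).2, x.2)))
    (fun x => (((e x.1.2).1, x.1.1), ((e x.1.2).2, x.2)))

omit [DecidableEq A'] in
lemma isOperation_purifyingEncoder {q : ℕ} (e : Fin q ≃ A' × Fin K) {S : Mat A'}
    (hS : (S * S.conjTranspose).trace = 1) : IsOperation (ofChoi (purifyingEncoder e S)) := by
  refine isOperation_ofChoi (Matrix.posSemidef_vecMulVec_self_star _) fun c a => ?_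
  have hS' : ∑ p, ∑ r, S p r * star (S p r) = 1 := by
    rw [← hS]; rfl
  rw [← hS', Fintype.sum_prod_type]
  have h : ∀ p, ∑ y, purifyingEncoder e S (c, (p, y)) (a, (p, y))
      = ∑ r, ∑ m, S p r * star (S p r) * if m = c ∧ m = a then 1 else 0 := by
    intro p
    rw [← Fintype.sum_prod_type', ← e.sum_comp]
    refine Finset.sum_congr rfl fun y _ => ?_
    simp only [purifyingEncoder, Matrix.vecMulVec_apply, Pi.star_apply, star_mul']
    by_cases h1 : (e y).2 = c <;> by_cases h2 : (e y).2 = a <;> simp [h1, h2]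
  simp only [h, ← Finset.mul_sum]
  by_cases hca : c = a
  · subst hca; simp
  · rw [if_neg hca]
    refine Finset.sum_eq_zero fun p _ => Finset.sum_eq_zero fun r _ => ?_
    rw [Finset.sum_eq_zero, mul_zero]
    rintro m -
    rw [if_neg]
    rintro ⟨rfl, rfl⟩
    exact hca rfl

lemma isOperation_measuringDecoder {q : ℕ} (e : Fin q ≃ A' × Fin K) {E : Mat (A' × B)} {t : ℂ}
    (hE : E.PosSemidef) (hE' : (1 - E).PosSemidef) (ht0 : 0 ≤ t) (hK : 1 ≤ K)
    (ht : t * ((K : ℂ) ^ 2 - 1) = 1 ∨ E = 1) :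
    IsOperation (ofChoi (measuringDecoder e E t)) := by
  refine isOperation_ofChoi (((posSemidef_kronecker hE (posSemidef_entOp K)).add
    ((posSemidef_kronecker hE' (posSemidef_sub_entOp hK)).smul ht0)).submatrix _) ?_
  rintro ⟨b, y⟩ ⟨b', y'⟩
  have h1 : ∀ c a : Fin K, ∑ k, entOp K (c, k) (a, k) = if c = a then 1 else 0 := by
    intro c a
    simp [entOp, @eq_comm _ c a]
  have h2 : ∀ c a : Fin K, ∑ k, ((K : ℂ) • 1 - entOp K) (c, k) (a, k)
      = ((K : ℂ) ^ 2 - 1) * if c = a then 1 else 0 := by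
    intro c a
    simp only [Matrix.sub_apply, Finset.sum_sub_distrib, h1, Matrix.smul_apply, Matrix.one_apply,
      Prod.mk.injEq, and_true]
    simp
    split_ifs <;> ring
  simp only [measuringDecoder, Matrix.submatrix_apply, Matrix.add_apply, Matrix.smul_apply,
    Matrix.kroneckerMap_apply, Finset.sum_add_distrib, ← Finset.mul_sum, smul_eq_mul, h1, h2]
  have h3 : ((e y).1, b) = ((e y').1, b') ∧ (e y).2 = (e y').2 ↔ (b, y) = (b', y') := by
    simp only [Prod.mk.injEq]
    rw [← e.apply_eq_iff_eq (x := y), Prod.ext_iff]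
    tauto
  rw [← if_congr h3 rfl rfl, ite_and]
  rcases ht with ht | rfl
  · rw [Matrix.sub_apply, Matrix.one_apply]
    by_cases ha : (e y).2 = (e y').2
    · simp only [ha, if_true, mul_one]
      linear_combination ((if ((e y).1, b) = ((e y').1, b') then (1 : ℂ) else 0)
        - E ((e y).1, b) ((e y').1, b')) * ht
    · simp [ha]
  · simp only [sub_self, Matrix.zero_apply, zero_mul, mul_zero, add_zero, Matrix.one_apply]
    split_ifs <;> simp

/-- The bipartite operation of the code that decodes by measuring an effect. The decoder preserves
the trace if `t (K 1 - entOp)` is the Choi matrix of a channel, or if the measurement never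
fails. -/
lemma exists_code_of_effect {S : Mat A'} {E : Mat (A' × B)} {t : ℂ}
    (hS : (S * S.conjTranspose).trace = 1) (hE : E.PosSemidef) (hE' : (1 - E).PosSemidef)
    (ht0 : 0 ≤ t) (hK : 1 ≤ K) (ht : t * ((K : ℂ) ^ 2 - 1) = 1 ∨ E = 1) :
    ∃ C : ForwardCode K A' B, bipartiteChoi C.bipartite
      = entOp K ⊗ₖ ((S ⊗ₖ (1 : Mat B)) * E * (S ⊗ₖ (1 : Mat B)).conjTranspose)
        + t • (((K : ℂ) • 1 - entOp K) ⊗ₖ ((S * S.conjTranspose) ⊗ₖ (1 : Mat B)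
          - (S ⊗ₖ (1 : Mat B)) * E * (S ⊗ₖ (1 : Mat B)).conjTranspose)) := by
  let e : Fin (Fintype.card (A' × Fin K)) ≃ A' × Fin K := (Fintype.equivFin _).symm
  let C : ForwardCode K A' B :=
    { q := Fintype.card (A' × Fin K)
      r := Fintype.card (A' × Fin K)
      enc := ofChoi (purifyingEncoder e S)
      side := LinearMap.id
      dec := ofChoi (measuringDecoder e E t)
      enc_isOperation := isOperation_purifyingEncoder e hS
      side_isOperation := isOperation_id
      dec_isOperation := isOperation_measuringDecoder e hE hE' ht0 hK ht }
  have hconj : ∀ (M : Mat (A' × B)) p b p' b',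
      ((S ⊗ₖ (1 : Mat B)) * M * (S ⊗ₖ (1 : Mat B)).conjTranspose) (p, b) (p', b')
        = ∑ r, ∑ r', S p r * star (S p' r') * M (r, b) (r', b') := by
    intro M p b p' b'
    rw [Matrix.conjTranspose_kronecker, Matrix.conjTranspose_one]
    simp only [Matrix.mul_apply, Fintype.sum_prod_type, Matrix.kroneckerMap_apply,
      Matrix.one_apply, mul_ite, mul_one, mul_zero, ite_mul, zero_mul, Finset.sum_ite_eq,
      Finset.sum_ite_eq', Finset.mem_univ, if_true, Matrix.conjTranspose_apply, Finset.sum_mul]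
    rw [Finset.sum_comm]
    refine Finset.sum_congr rfl fun r _ => Finset.sum_congr rfl fun r' _ => ?_
    ring
  have hρ : (S * S.conjTranspose) ⊗ₖ (1 : Mat B)
        - (S ⊗ₖ (1 : Mat B)) * E * (S ⊗ₖ (1 : Mat B)).conjTranspose
      = (S ⊗ₖ (1 : Mat B)) * (1 - E) * (S ⊗ₖ (1 : Mat B)).conjTranspose := by
    rw [mul_sub, sub_mul, mul_one]
    congr 1
    rw [Matrix.conjTranspose_kronecker, ← Matrix.mul_kronecker_mul]
    simp
  refine ⟨C, ?_⟩
  rw [hρ]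
  ext ⟨⟨c, k⟩, ⟨p, b⟩⟩ ⟨⟨a, k'⟩, ⟨p', b'⟩⟩
  rw [bipartiteChoi_apply, ForwardCode.bipartite_single]
  change ofChoi (measuringDecoder e E t) (Matrix.single b b' 1 ⊗ₖ (Matrix.of fun y y' =>
    ofChoi (purifyingEncoder e S) (Matrix.single c a 1) (p, y) (p', y'))) k k' = _
  simp only [ofChoi_single]
  rw [ofChoi_apply]
  have hL : ∀ f : B × Fin (Fintype.card (A' × Fin K)) → B × Fin (Fintype.card (A' × Fin K)) → ℂ,
      ∑ x, ∑ x', (Matrix.single b b' 1 ⊗ₖ (Matrix.of fun y y' =>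
        purifyingEncoder e S (c, (p, y)) (a, (p', y')))) x x' * f x x'
      = ∑ r, ∑ r', S p r * star (S p' r') * f (b, e.symm (r, c)) (b', e.symm (r', a)) := by
    intro f
    simp only [Fintype.sum_prod_type, Matrix.kroneckerMap_apply, Matrix.of_apply]
    rw [Finset.sum_eq_single b]
    · rw [← e.symm.sum_comp]
      rw [Fintype.sum_prod_type]
      refine Finset.sum_congr rfl fun r _ => ?_
      rw [Finset.sum_eq_single c]
      · rw [Finset.sum_eq_single b']
        · rw [← e.symm.sum_comp, Fintype.sum_prod_type]
          refine Finset.sum_congr rfl fun r' _ => ?_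
          rw [Finset.sum_eq_single a]
          · simp [purifyingEncoder, Matrix.vecMulVec_apply]
          · intro m _ hm
            simp [purifyingEncoder, Matrix.vecMulVec_apply, hm]
          · simp
        · intro m _ hm
          simp [hm.symm]
        · simp
      · intro m _ hm
        simp [purifyingEncoder, Matrix.vecMulVec_apply, hm]
      · simp
    · intro m _ hm
      simp [hm.symm]
    · simp
  rw [hL]
  simp only [measuringDecoder, Matrix.submatrix_apply, Matrix.add_apply, Matrix.smul_apply,
    Matrix.kroneckerMap_apply, smul_eq_mul, Equiv.apply_symm_apply, hconj, Finset.mul_sum,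
    ← Finset.sum_add_distrib]
  refine Finset.sum_congr rfl fun r _ => Finset.sum_congr rfl fun r' _ => ?_
  ring

end Construction

section Twirled

variable {K : ℕ} {A' B : Type*} [Fintype A'] [Fintype B] [DecidableEq A'] [DecidableEq B]
  {ρ : Mat A'} {Λ : Mat (A' × B)}

lemma contractLeft_kronecker {Q R : Type*} [Fintype Q] (X Y : Mat Q) (M : Mat R) :
    contractLeft X (Y ⊗ₖ M) = (∑ q, ∑ q', X q q' * Y q q') • M := by
  ext r r'
  simp [contractLeft_apply, Matrix.kroneckerMap_apply, Finset.sum_mul, mul_assoc]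

lemma inv_sq_sub_one_nonneg (hK : 1 ≤ K) : (0 : ℂ) ≤ ((K : ℂ) ^ 2 - 1)⁻¹ := by
  have h1 : (1 : ℝ) ≤ (K : ℝ) := by exact_mod_cast hK
  have h2 : (0 : ℝ) ≤ ((K : ℝ) ^ 2 - 1)⁻¹ := inv_nonneg.2 (by nlinarith)
  have h3 := Complex.zero_le_real.2 h2
  push_cast at h3
  exact h3

lemma sq_sub_one_ne_zero (hK : 1 ≤ K) (hK1 : K ≠ 1) : (K : ℂ) ^ 2 - 1 ≠ 0 := by
  have h1 : (2 : ℝ) ≤ (K : ℝ) := by exact_mod_cast (by omega : 2 ≤ K)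
  have h2 : ((K : ℝ) ^ 2 - 1) ≠ 0 := by nlinarith
  exact_mod_cast h2

/-- For every feasible pair with `Λ = ρ ⊗ 1` if `K = 1`, there is a code whose bipartite operation
is the twirled operation with Choi matrix `entOp ⊗ Λ + (K 1 - entOp) ⊗ (ρ ⊗ 1 - Λ) / (K² - 1)`. -/
lemma exists_code (hρ : ρ.PosSemidef) (htr : ρ.trace = 1) (hΛ : Λ.PosSemidef)
    (hle : (ρ ⊗ₖ (1 : Mat B) - Λ).PosSemidef) (hK : 1 ≤ K) (hK1 : K = 1 → Λ = ρ ⊗ₖ (1 : Mat B)) :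
    ∃ C : ForwardCode K A' B, bipartiteChoi C.bipartite
      = entOp K ⊗ₖ Λ
        + ((K : ℂ) ^ 2 - 1)⁻¹ • (((K : ℂ) • 1 - entOp K) ⊗ₖ (ρ ⊗ₖ (1 : Mat B) - Λ)) := by
  have ht0 := inv_sq_sub_one_nonneg hK
  obtain ⟨S, E, hS, hE, hE', hSE⟩ := exists_effect hρ hΛ hle
  by_cases h : K = 1
  · obtain ⟨C, hC⟩ := exists_code_of_effect (S := S) (E := (1 : Mat (A' × B)))
      (by rw [hS, htr]) .one (by rw [sub_self]; exact .zero) ht0 hK (Or.inr rfl)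
    refine ⟨C, ?_⟩
    rw [hC, hK1 h, hS, mul_one, Matrix.conjTranspose_kronecker, ← Matrix.mul_kronecker_mul, hS]
    simp
  · obtain ⟨C, hC⟩ := exists_code_of_effect (S := S) (by rw [hS, htr]) hE hE' ht0 hK
      (Or.inl (inv_mul_cancel₀ (sq_sub_one_ne_zero hK h)))
    exact ⟨C, by rw [hC, hS, hSE]⟩

variable {C : ForwardCode K A' B} {t : ℂ}

omit [DecidableEq A'] in
lemma lamOp_of_bipartiteChoi (hK : 1 ≤ K) (hC : bipartiteChoi C.bipartite
      = entOp K ⊗ₖ Λ + t • (((K : ℂ) • 1 - entOp K) ⊗ₖ (ρ ⊗ₖ (1 : Mat B) - Λ))) :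
    C.lamOp = Λ := by
  have hK0 : (K : ℂ) ≠ 0 := by exact_mod_cast (by omega : K ≠ 0)
  have h1 : ∑ q, ∑ q', entOp K q q' * entOp K q q' = (K : ℂ) ^ 2 := by
    simp [Fintype.sum_prod_type, entOp, sq]
  have h2 : ∑ q, ∑ q', entOp K q q' * ((K : ℂ) • 1 - entOp K) q q' = 0 := by
    simp only [Matrix.sub_apply, mul_sub, Finset.sum_sub_distrib, h1]
    simp [Fintype.sum_prod_type, entOp, sq, Matrix.one_apply]
  have hadd : ∀ (c : ℂ) (X Y : Mat ((Fin K × Fin K) × (A' × B))),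
      contractLeft (entOp K) (X + c • Y)
        = contractLeft (entOp K) X + c • contractLeft (entOp K) Y := by
    intro c X Y
    ext r r'
    simp [contractLeft_apply, mul_add, Finset.sum_add_distrib, Finset.mul_sum, mul_left_comm]
  rw [ForwardCode.lamOp, hC, hadd, contractLeft_kronecker, contractLeft_kronecker, h1, h2,
    zero_smul, smul_zero, add_zero, smul_smul, inv_mul_cancel₀ (pow_ne_zero 2 hK0), one_smul]

omit [DecidableEq A'] in
lemma nonSignalling_of_bipartiteChoi (hK : 1 ≤ K) (htr : ρ.trace = 1)
    (hC : bipartiteChoi C.bipartite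
      = entOp K ⊗ₖ Λ + t • (((K : ℂ) • 1 - entOp K) ⊗ₖ (ρ ⊗ₖ (1 : Mat B) - Λ)))
    (ht : t * ((K : ℂ) ^ 2 - 1) = 1 ∨ K = 1)
    (hΛ : traceLeft Λ = ((K : ℂ) ^ 2)⁻¹ • (1 : Mat B)) :
    NonSignallingAliceToBob C.bipartite := by
  have hK0 : (K : ℂ) ≠ 0 := by exact_mod_cast (by omega : K ≠ 0)
  -- Bob's marginal output is completely mixed, whatever his input.
  refine ⟨ofChoi ((K : ℂ)⁻¹ • 1), isOperation_ofChoi (Matrix.PosSemidef.one.smul (by positivity))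
    fun b b' => ?_, fun X => ?_⟩
  · by_cases h : b = b' <;> simp [h, hK0]
  have hsum : ∀ (c a k k' : Fin K) (b b' : B),
      ∑ p, bipartiteChoi C.bipartite ((c, k), (p, b)) ((a, k'), (p, b'))
        = (K : ℂ)⁻¹ * ((1 : Mat (Fin K × Fin K)) (c, k) (a, k') * (1 : Mat B) b b') := by
    intro c a k k' b b'
    have h1 : ∑ p, Λ (p, b) (p, b') = ((K : ℂ) ^ 2)⁻¹ * (1 : Mat B) b b' :=
      congrFun (congrFun hΛ b) b'
    have h2 : ∑ p, ρ p p * (1 : Mat B) b b' = (1 : Mat B) b b' := by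
      rw [← Finset.sum_mul, show ∑ p, ρ p p = 1 from htr, one_mul]
    simp only [hC, Matrix.add_apply, Matrix.smul_apply, Matrix.kroneckerMap_apply, smul_eq_mul,
      Matrix.sub_apply, Finset.sum_add_distrib, ← Finset.mul_sum, Finset.sum_sub_distrib, h1, h2]
    rcases ht with ht | rfl
    · have ht' : t * (1 - ((K : ℂ) ^ 2)⁻¹) = ((K : ℂ) ^ 2)⁻¹ := by
        field_simp
        exact ht
      have hKK : (K : ℂ) * ((K : ℂ) ^ 2)⁻¹ = (K : ℂ)⁻¹ := by
        field_simp
      linear_combination (((K : ℂ) * (1 : Mat (Fin K × Fin K)) (c, k) (a, k')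
        - entOp K (c, k) (a, k')) * (1 : Mat B) b b') * ht'
        + ((1 : Mat (Fin K × Fin K)) (c, k) (a, k') * (1 : Mat B) b b') * hKK
    · have h3 : ∀ x y, entOp 1 x y = 1 := fun x y => by
        simp [entOp, Subsingleton.elim x.1 x.2, Subsingleton.elim y.1 y.2]
      rw [h3, Subsingleton.elim (c, k) (a, k'), Matrix.one_apply_eq]
      simp
  ext k k'
  change ∑ p, C.bipartite X (p, k) (p, k') = _
  simp only [apply_eq_sum_choi C.bipartite, ofChoi_apply]
  have hX : ∑ p, ∑ x, ∑ y, X x y * choi C.bipartite (x, (p, k)) (y, (p, k'))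
      = ∑ x, ∑ y, X x y * ((K : ℂ)⁻¹ *
        ((1 : Mat (Fin K × Fin K)) (x.1, k) (y.1, k') * (1 : Mat B) x.2 y.2)) := by
    rw [Finset.sum_comm]
    refine Finset.sum_congr rfl fun x _ => ?_
    rw [Finset.sum_comm]
    refine Finset.sum_congr rfl fun y _ => ?_
    rw [← Finset.mul_sum, ← hsum]
    rfl
  rw [hX]
  by_cases hk : k = k'
  · subst hk
    simp only [Fintype.sum_prod_type, Matrix.one_apply, Matrix.smul_apply, traceLeft,
      Matrix.of_apply, Prod.mk.injEq, and_true, smul_eq_mul]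
    simp only [mul_ite, mul_one, mul_zero, Finset.sum_ite_eq, Finset.mem_univ, if_true,
      Finset.sum_mul]
    exact Finset.sum_comm
  · simp [Matrix.one_apply, hk]

omit [DecidableEq A'] in
lemma pptPreserving_of_bipartiteChoi (hK : 1 ≤ K) (hρ : ρ.PosSemidef)
    (hC : bipartiteChoi C.bipartite
      = entOp K ⊗ₖ Λ + t • (((K : ℂ) • 1 - entOp K) ⊗ₖ (ρ ⊗ₖ (1 : Mat B) - Λ)))
    (ht0 : 0 ≤ t) (ht : t * ((K : ℂ) ^ 2 - 1) = 1 ∨ (K = 1 ∧ Λ = ρ ⊗ₖ (1 : Mat B)))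
    (h₁ : (transposeRight Λ - (-((K : ℂ)⁻¹ • (ρ ⊗ₖ (1 : Mat B))))).PosSemidef)
    (h₂ : ((K : ℂ)⁻¹ • (ρ ⊗ₖ (1 : Mat B)) - transposeRight Λ).PosSemidef) :
    PPTPreserving C.bipartite := by
  have hK0 : (K : ℂ) ≠ 0 := by exact_mod_cast (by omega : K ≠ 0)
  refine pptPreserving_of_choi ((posSemidef_bipartiteChoi_iff _).1 ?_)
  have hW : bipartiteChoi (partialTransposeMap C.bipartite) = flipOp K ⊗ₖ transposeRight Λ
      + t • (((K : ℂ) • 1 - flipOp K) ⊗ₖ (ρ ⊗ₖ (1 : Mat B) - transposeRight Λ)) := by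
    ext ⟨⟨c, k⟩, ⟨p, b⟩⟩ ⟨⟨a, k'⟩, ⟨p', b'⟩⟩
    rw [bipartiteChoi_partialTransposeMap_apply, ← bipartiteChoi_apply, hC]
    simp only [Matrix.add_apply, Matrix.smul_apply, Matrix.kroneckerMap_apply, Matrix.sub_apply,
      transposeRight, flipOp, entOp, Matrix.of_apply, Matrix.one_apply, Prod.mk.injEq,
      @eq_comm _ b' b, @eq_comm _ k' k]
  rw [hW]
  rcases ht with ht | ⟨rfl, hΛ⟩
  · -- With `t = 1 / (K² - 1)` one has `t K (K ∓ 1) = K / (K ± 1)`; these are the coefficients of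
    -- the decomposition over the symmetric and the antisymmetric projector `(1 ± flipOp) / 2`.
    have hK1 : (0 : ℂ) ≤ (K : ℂ) - 1 := by
      have h1 : (0 : ℝ) ≤ (K : ℝ) - 1 := sub_nonneg.2 (by exact_mod_cast hK)
      exact_mod_cast h1
    have h := ((posSemidef_kronecker (posSemidef_one_add_flipOp K) h₁).smul
      (a := t * K * (K - 1) * 2⁻¹) (by positivity)).add
      ((posSemidef_kronecker (posSemidef_one_sub_flipOp K) h₂).smul
      (a := t * K * (K + 1) * 2⁻¹) (by positivity))
    convert h using 1
    ext x y
    simp only [Matrix.add_apply, Matrix.smul_apply, Matrix.kroneckerMap_apply, Matrix.sub_apply,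
      Matrix.neg_apply, smul_eq_mul]
    have hKK : (K : ℂ) * (K : ℂ)⁻¹ = 1 := mul_inv_cancel₀ hK0
    linear_combination (-(flipOp K x.1 y.1 * transposeRight Λ x.2 y.2)) * ht
      - (ρ x.2.1 y.2.1 * (1 : Mat B) x.2.2 y.2.2 * t
        * (K * (1 : Mat (Fin K × Fin K)) x.1 y.1 - flipOp K x.1 y.1)) * hKK
  · have h1 : flipOp 1 = 1 := by
      ext x y
      rw [Subsingleton.elim x y, Matrix.one_apply_eq]
      simp [flipOp, Subsingleton.elim y.1 y.2]
    rw [hΛ, transposeRight_kronecker_one, sub_self, h1]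
    have h := posSemidef_kronecker (X := (1 : Mat (Fin 1 × Fin 1))) .one
      (posSemidef_kronecker hρ (.one (n := B)))
    convert h using 1
    ext x y
    simp [Matrix.kroneckerMap_apply]

end Twirled

/-! ### Linear matrix inequalities -/

section LMI

instance {Q : Type*} [Fintype Q] : FiniteDimensional ℝ (Herm Q) :=
  inferInstanceAs (FiniteDimensional ℝ (selfAdjoint.submodule ℝ (Mat Q)))

instance {Q : Type*} : ContinuousSMul ℝ (Herm Q) :=
  inferInstanceAs (ContinuousSMul ℝ (selfAdjoint.submodule ℝ (Mat Q)))

variable {V : Type*} [AddCommGroup V] [Module ℝ V]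

/-- Sets that are described by a linear matrix inequality `F₀ + L x ≥ 0`. -/
def IsLMI (s : Set V) : Prop :=
  ∃ (n : ℕ) (F₀ : Herm (Fin n)) (L : V →ₗ[ℝ] Herm (Fin n)),
    s = {x | ((F₀ + L x : Herm (Fin n)) : Mat (Fin n)).PosSemidef}

/-- An affine function with Hermitian values, on an arbitrary finite index type, gives a linear
matrix inequality. -/
lemma isLMI_posSemidef {Q : Type*} [Fintype Q] (F : V → Mat Q) (hF : ∀ x, (F x).IsHermitian)
    (hL : IsLinearMap ℝ fun x => F x - F 0) : IsLMI {x | (F x).PosSemidef} := by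
  let e := Fintype.equivFin Q
  refine ⟨Fintype.card Q, ⟨(F 0).submatrix e.symm e.symm, ((hF 0).submatrix _ :)⟩,
    { toFun := fun x => ⟨(F x - F 0).submatrix e.symm e.symm,
        (((hF x).sub (hF 0)).submatrix _ :)⟩
      map_add' := fun x y => Subtype.ext ?_
      map_smul' := fun c x => Subtype.ext ?_ }, ?_⟩
  · change Matrix.submatrix (F (x + y) - F 0) _ _ = _
    rw [hL.map_add]; rfl
  · change Matrix.submatrix (F (c • x) - F 0) _ _ = _
    rw [hL.map_smul]; rfl
  · ext x
    change _ ↔ ((F 0).submatrix e.symm e.symm + (F x - F 0).submatrix e.symm e.symm).PosSemidef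
    have h : (F 0).submatrix e.symm e.symm + (F x - F 0).submatrix e.symm e.symm
        = (F x).submatrix e.symm e.symm := by
      ext i j
      simp
    rw [h]
    exact (Matrix.posSemidef_submatrix_equiv e.symm).symm

lemma posSemidef_fromBlocks_iff {m n : Type*} [Fintype m] [Fintype n] {A : Mat m} {D : Mat n} :
    (Matrix.fromBlocks A 0 0 D).PosSemidef ↔ A.PosSemidef ∧ D.PosSemidef := by
  classical
  refine ⟨fun h => ⟨h.submatrix Sum.inl, h.submatrix Sum.inr⟩, fun ⟨hA, hD⟩ => ?_⟩
  have h := (hA.conjTranspose_mul_mul_same (Matrix.fromCols (1 : Mat m) (0 : Matrix m n ℂ))).add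
    (hD.conjTranspose_mul_mul_same (Matrix.fromCols (0 : Matrix n m ℂ) (1 : Mat n)))
  convert h using 1
  ext (i | i) (j | j) <;>
    simp [Matrix.mul_apply, Matrix.conjTranspose_apply, Matrix.one_apply, apply_ite]

lemma IsLMI.inter {s t : Set V} (hs : IsLMI s) (ht : IsLMI t) : IsLMI (s ∩ t) := by
  obtain ⟨m, F, L, rfl⟩ := hs
  obtain ⟨n, G, M, rfl⟩ := ht
  have h := isLMI_posSemidef (V := V) (Q := Fin m ⊕ Fin n)
    (fun x => Matrix.fromBlocks ((F + L x : Herm (Fin m)) : Mat (Fin m)) 0 0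
      ((G + M x : Herm (Fin n)) : Mat (Fin n)))
    (fun x => Matrix.IsHermitian.fromBlocks (F + L x).2 (by simp) (G + M x).2)
    { map_add := fun x y => by
        ext (i | i) (j | j) <;> simp
      map_smul := fun c x => by
        ext (i | i) (j | j) <;> simp }
  simpa only [posSemidef_fromBlocks_iff, Set.ofPred_and] using h

open scoped MatrixOrder in
/-- An equality of Hermitian operators is a pair of inequalities. -/
lemma isLMI_eq_zero {Q : Type*} [Fintype Q] (F : V → Mat Q) (hF : ∀ x, (F x).IsHermitian)
    (hL : IsLinearMap ℝ fun x => F x - F 0) : IsLMI {x | F x = 0} := by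
  have h := (isLMI_posSemidef F hF hL).inter (isLMI_posSemidef (fun x => -F x)
    (fun x => (hF x).neg)
    { map_add := fun x y => by
        have h := hL.map_add x y
        rw [sub_eq_iff_eq_add] at h
        rw [h]
        abel
      map_smul := fun c x => by
        have h := hL.map_smul c x
        rw [sub_eq_iff_eq_add] at h
        have h' : -F x - -F 0 = -(F x - F 0) := by abel
        rw [h, h', smul_neg]
        abel })
  convert h using 1
  ext x
  refine ⟨fun hx => ?_, fun ⟨h₁, h₂⟩ => ?_⟩
  · change F x = 0 at hx
    simp [hx, Matrix.PosSemidef.zero]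
  · exact le_antisymm (by rw [Matrix.le_iff, zero_sub]; exact h₂) (Matrix.PosSemidef.nonneg h₁)

lemma isClosed_posSemidef {Q : Type*} [Fintype Q] : IsClosed {X : Mat Q | X.PosSemidef} := by
  simp only [Matrix.posSemidef_iff_dotProduct_mulVec, Set.ofPred_and, Set.ofPred_forall]
  refine (isClosed_eq (by fun_prop) continuous_id).inter (isClosed_iInter fun x => ?_)
  exact isClosed_le continuous_const (by fun_prop)

lemma IsLMI.isClosed [TopologicalSpace V] [IsTopologicalAddGroup V] [ContinuousSMul ℝ V] [T2Space V]
    [FiniteDimensional ℝ V] {s : Set V} (hs : IsLMI s) : IsClosed s := by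
  obtain ⟨n, F, L, rfl⟩ := hs
  exact isClosed_posSemidef.preimage
    (continuous_subtype_val.comp (continuous_const.add L.continuous_of_finiteDimensional))

end LMI

/-! ### The three semidefinite programs -/

section Program

variable {A' B : Type*} [Fintype A'] [Fintype B] [DecidableEq A'] [DecidableEq B]

lemma isHermitian_transposeRight {P Q : Type*} {X : Mat (P × Q)} (hX : X.IsHermitian) :
    (transposeRight X).IsHermitian := by
  ext x y
  exact congrFun (congrFun hX (x.1, y.2)) (y.1, x.2)

lemma isHermitian_traceLeft {P Q : Type*} [Fintype P] {X : Mat (P × Q)} (hX : X.IsHermitian) :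
    (traceLeft X).IsHermitian := by
  ext q q'
  simp only [traceLeft, Matrix.conjTranspose_apply, Matrix.of_apply, star_sum]
  exact Finset.sum_congr rfl fun p _ => congrFun (congrFun hX (p, q)) (p, q')

omit [Fintype B] in
lemma isHermitian_kronecker_one {P : Type*} {X : Mat P} (hX : X.IsHermitian) :
    (X ⊗ₖ (1 : Mat B)).IsHermitian := by
  rw [Matrix.IsHermitian, Matrix.conjTranspose_kronecker, hX.eq, Matrix.conjTranspose_one]

lemma isHermitian_inv_natCast_smul {P : Type*} {X : Mat P} (hX : X.IsHermitian) (K : ℕ) :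
    ((K : ℂ)⁻¹ • X).IsHermitian := by
  rw [Matrix.IsHermitian, Matrix.conjTranspose_smul, hX.eq]
  simp

omit [DecidableEq A'] in
lemma isLMI_baseConstraints : IsLMI (baseConstraints A' B) := by
  have h1 : IsLMI {x : Vars A' B | (x.1 : Mat A').PosSemidef} :=
    isLMI_posSemidef _ (fun x => x.1.2)
      { map_add := fun x y => by ext i j; simp
        map_smul := fun c x => by ext i j; simp }
  have h2 : IsLMI {x : Vars A' B | ((x.1 : Mat A').trace - 1) • (1 : Mat Unit) = 0} :=
    isLMI_eq_zero _ (fun x => by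
        have h : star (x.1 : Mat A').trace = (x.1 : Mat A').trace := by
          rw [← Matrix.trace_conjTranspose, (show (x.1 : Mat A').IsHermitian from x.1.2).eq]
        rw [Matrix.IsHermitian, Matrix.conjTranspose_smul, star_sub, h]
        simp)
      { map_add := fun x y => by ext i j; simp [Matrix.trace_add]
        map_smul := fun c x => by ext i j; simp [Matrix.trace_smul] }
  have h3 : IsLMI {x : Vars A' B | (x.2 : Mat (A' × B)).PosSemidef} :=
    isLMI_posSemidef _ (fun x => x.2.2)
      { map_add := fun x y => by ext i j; simp
        map_smul := fun c x => by ext i j; simp }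
  have h4 : IsLMI {x : Vars A' B |
      ((x.1 : Mat A') ⊗ₖ (1 : Mat B) - (x.2 : Mat (A' × B))).PosSemidef} :=
    isLMI_posSemidef _ (fun x => (isHermitian_kronecker_one x.1.2).sub x.2.2)
      { map_add := fun x y => by ext i j; simp [Matrix.kroneckerMap_apply]; ring
        map_smul := fun c x => by ext i j; simp [Matrix.kroneckerMap_apply]; ring }
  convert h1.inter (h2.inter (h3.inter h4)) using 1
  ext x
  have h : ((x.1 : Mat A').trace - 1) • (1 : Mat Unit) = 0 ↔ (x.1 : Mat A').trace = 1 := by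
    rw [smul_eq_zero, sub_eq_zero]
    simp
  change _ ↔ _ ∧ _ = _ ∧ _ ∧ _
  rw [h]
  rfl

omit [DecidableEq A'] in
lemma isLMI_constraintNS (K : ℕ) : IsLMI (constraintNS A' B K) := by
  have h : IsLMI {x : Vars A' B |
      traceLeft (x.2 : Mat (A' × B)) - ((K : ℂ) ^ 2)⁻¹ • (1 : Mat B) = 0} :=
    isLMI_eq_zero _ (fun x => (isHermitian_traceLeft x.2.2).sub (by
        have := isHermitian_inv_natCast_smul (Matrix.isHermitian_one (n := B) (α := ℂ)) (K ^ 2)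
        push_cast at this
        exact this))
      { map_add := fun x y => by ext i j; simp [traceLeft, Finset.sum_add_distrib]
        map_smul := fun c x => by ext i j; simp [traceLeft, Finset.mul_sum] }
  simp only [sub_eq_zero] at h
  exact h

omit [DecidableEq A'] in
lemma isLMI_constraintPPTp (K : ℕ) : IsLMI (constraintPPTp A' B K) := by
  refine IsLMI.inter (isLMI_posSemidef _ (fun x => (isHermitian_transposeRight x.2.2).sub
      (isHermitian_inv_natCast_smul (isHermitian_kronecker_one x.1.2) K).neg)
      { map_add := fun x y => ?_, map_smul := fun c x => ?_ })
    (isLMI_posSemidef _ (fun x => (isHermitian_inv_natCast_smul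
      (isHermitian_kronecker_one x.1.2) K).sub (isHermitian_transposeRight x.2.2))
      { map_add := fun x y => ?_, map_smul := fun c x => ?_ }) <;>
  · ext i j
    simp [transposeRight, Matrix.kroneckerMap_apply]
    ring

lemma isSemidefiniteProgram_objective (N : Mat A' →ₗ[ℂ] Mat B) {s : Set (Vars A' B)}
    (hs : IsLMI s) : IsSemidefiniteProgram (objective N) s := by
  obtain ⟨n, F, L, h⟩ := hs
  have hc : IsLinearMap ℝ (objective N) :=
    { map_add := fun x y => by simp [objective, Matrix.mul_add, Matrix.trace_add]
      map_smul := fun c x => by simp [objective, Matrix.trace_smul] }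
  exact ⟨inferInstance, hc.mk' _, n, F, L, fun _ => rfl, h⟩

/-! ### Attainment of the optimum -/

lemma norm_apply_le_of_posSemidef {Q : Type*} [Fintype Q] {X : Mat Q} (hX : X.PosSemidef)
    (i j : Q) :
    ‖X i j‖ ≤ X.trace.re := by
  classical
  open scoped MatrixOrder in
  obtain ⟨G, hG⟩ := CStarAlgebra.nonneg_iff_eq_star_mul_self.mp hX.nonneg
  have hap : ∀ i j, X i j = ∑ k, star (G k i) * G k j := by
    intro i j
    rw [hG, Matrix.star_eq_conjTranspose]
    rfl
  have hdiag : ∀ i, (X i i).re = ∑ k, ‖G k i‖ ^ 2 := by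
    intro i
    rw [hap, Complex.re_sum]
    refine Finset.sum_congr rfl fun k _ => ?_
    rw [Complex.star_def, ← Complex.normSq_eq_conj_mul_self, Complex.ofReal_re,
      Complex.normSq_eq_norm_sq]
  have hle : ∀ i, ∑ k, ‖G k i‖ ^ 2 ≤ X.trace.re := by
    intro i
    rw [Matrix.trace, Complex.re_sum]
    simp only [Matrix.diag_apply, hdiag]
    exact Finset.single_le_sum (f := fun i => ∑ k, ‖G k i‖ ^ 2)
      (fun i _ => Finset.sum_nonneg fun k _ => sq_nonneg _) (Finset.mem_univ i)
  have h2 : ‖X i j‖ ≤ ∑ k, (‖G k i‖ ^ 2 / 2 + ‖G k j‖ ^ 2 / 2) := by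
    rw [hap]
    refine (norm_sum_le _ _).trans (Finset.sum_le_sum fun k _ => ?_)
    rw [norm_mul, norm_star]
    nlinarith [sq_nonneg (‖G k i‖ - ‖G k j‖)]
  rw [Finset.sum_add_distrib, ← Finset.sum_div, ← Finset.sum_div] at h2
  linarith [hle i, hle j]

lemma isCompact_entries_le (Q : Type*) [Fintype Q] (c : ℝ) :
    IsCompact {X : Mat Q | ∀ i j, X i j ∈ Metric.closedBall (0 : ℂ) c} := by
  have h := isCompact_univ_pi fun _ : Q => isCompact_univ_pi fun _ : Q =>
    isCompact_closedBall (0 : ℂ) c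
  have he : {X : Mat Q | ∀ i j, X i j ∈ Metric.closedBall (0 : ℂ) c}
      = Set.univ.pi fun _ : Q => Set.univ.pi fun _ : Q => Metric.closedBall (0 : ℂ) c := by
    exact Set.ext fun X => ⟨fun hX i _ j _ => hX i j, fun hX i j => hX i trivial j trivial⟩
  rw [he]
  exact h

lemma isClosedEmbedding_herm {Q : Type*} :
    Topology.IsClosedEmbedding ((↑) : Herm Q → Mat Q) :=
  IsClosed.isClosedEmbedding_subtypeVal
    (isClosed_eq (f := fun X : Mat Q => star X) continuous_star continuous_id)

omit [DecidableEq A'] in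
/-- Feasible sets are closed, and bounded because the trace of a positive semidefinite operator
bounds its entries. -/
lemma isCompact_of_subset_baseConstraints {s : Set (Vars A' B)} (hs : IsLMI s)
    (hsub : s ⊆ baseConstraints A' B) : IsCompact s := by
  have hK := (isClosedEmbedding_herm.prodMap isClosedEmbedding_herm).isCompact_preimage
    ((isCompact_entries_le A' 1).prod (isCompact_entries_le (A' × B) (Fintype.card B)))
  refine hK.of_isClosed_subset hs.isClosed fun x hx => ?_
  obtain ⟨h1, h2, h3, h4⟩ := hsub hx
  refine ⟨fun i j => ?_, fun i j => ?_⟩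
  · rw [mem_closedBall_zero_iff]
    refine (norm_apply_le_of_posSemidef h1 i j).trans ?_
    rw [h2, Complex.one_re]
  · rw [mem_closedBall_zero_iff]
    refine (norm_apply_le_of_posSemidef h3 i j).trans ?_
    have h := (Complex.le_def.1 h4.trace_nonneg).1
    rw [Matrix.trace_sub, Matrix.trace_kronecker, h2, Matrix.trace_one] at h
    simp at h
    exact h

omit [DecidableEq B] in
lemma continuous_objective (N : Mat A' →ₗ[ℂ] Mat B) : Continuous (objective N) := by
  unfold objective
  fun_prop

end Program

section Optimum

variable {A' B : Type*} [Fintype A'] [Fintype B] [DecidableEq A'] [DecidableEq B] {K : ℕ}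

open scoped MatrixOrder in
lemma trace_mul_nonneg_of_posSemidef {Q : Type*} [Fintype Q] {X Y : Mat Q} (hX : X.PosSemidef)
    (hY : Y.PosSemidef) : 0 ≤ (X * Y).trace := by
  classical
  obtain ⟨G, rfl⟩ := CStarAlgebra.nonneg_iff_eq_star_mul_self.mp hX.nonneg
  rw [Matrix.star_eq_conjTranspose, Matrix.mul_assoc, Matrix.trace_mul_comm]
  exact (hY.mul_mul_conjTranspose_same G).trace_nonneg

/-- Every code gives a feasible point of the same value. -/
lemma exists_feasible_of_code [Nonempty B] (hK : 1 ≤ K) (N : Mat A' →ₗ[ℂ] Mat B)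
    (C : ForwardCode K A' B) :
    ∃ x ∈ baseConstraints A' B, objective N x = channelFidelity (C.overall N) ∧
      (C ∈ codesNS K A' B → x ∈ constraintNS A' B K) ∧
      (C ∈ codesPPTp K A' B → x ∈ constraintPPTp A' B K) :=
  ⟨(⟨C.inputState, C.posSemidef_inputState.isHermitian⟩,
      ⟨C.lamOp, C.posSemidef_lamOp.isHermitian⟩),
    ⟨C.posSemidef_inputState, C.trace_inputState hK, C.posSemidef_lamOp,
      C.posSemidef_inputState_sub_lamOp hK⟩,
    (C.channelFidelity_overall N).symm, fun h => C.traceLeft_lamOp h,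
    fun h => C.posSemidef_transposeRight_lamOp h hK⟩

/-- Every feasible point is matched by a code of at least the same value. The inequality is only
needed for `K = 1`, where `Λ` is first increased to `ρ ⊗ 1`. -/
lemma exists_code_of_feasible (hK : 1 ≤ K) {N : Mat A' →ₗ[ℂ] Mat B} (hN : IsOperation N)
    {x : Vars A' B} (hx : x ∈ baseConstraints A' B) :
    ∃ C : ForwardCode K A' B, objective N x ≤ channelFidelity (C.overall N) ∧
      (x ∈ constraintNS A' B K → C ∈ codesNS K A' B) ∧
      (x ∈ constraintPPTp A' B K → C ∈ codesPPTp K A' B) := by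
  obtain ⟨h1, h2, h3, h4⟩ := hx
  have ht0 := inv_sq_sub_one_nonneg hK
  by_cases h : K = 1
  · subst h
    have hρ1 : ((x.1 : Mat A') ⊗ₖ (1 : Mat B)).PosSemidef := posSemidef_kronecker h1 .one
    obtain ⟨C, hC⟩ := exists_code (K := 1) h1 h2 hρ1
      (by rw [sub_self]; exact .zero) le_rfl fun _ => rfl
    refine ⟨C, ?_, fun _ => nonSignalling_of_bipartiteChoi le_rfl h2 hC (Or.inr rfl) ?_,
      fun hP => pptPreserving_of_bipartiteChoi le_rfl h1 hC ht0 (Or.inr ⟨rfl, rfl⟩) ?_ ?_⟩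
    · have hT := trace_mul_nonneg_of_posSemidef
        (hN.completelyPositive.posSemidef_choi).transpose h4
      rw [C.channelFidelity_overall, lamOp_of_bipartiteChoi le_rfl hC, objective]
      rw [mul_sub, Matrix.trace_sub, sub_nonneg] at hT
      exact (Complex.le_def.1 hT).1
    · ext b b'
      change ∑ p, (x.1 : Mat A') p p * (1 : Mat B) b b' = _
      rw [← Finset.sum_mul, show ∑ p, (x.1 : Mat A') p p = 1 from h2]
      simp
    · rw [transposeRight_kronecker_one, sub_neg_eq_add]
      exact hρ1.add (hρ1.smul (by simp))
    · rw [transposeRight_kronecker_one]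
      simpa using Matrix.PosSemidef.zero
  · have ht : ((K : ℂ) ^ 2 - 1)⁻¹ * ((K : ℂ) ^ 2 - 1) = 1 :=
      inv_mul_cancel₀ (sq_sub_one_ne_zero hK h)
    obtain ⟨C, hC⟩ := exists_code h1 h2 h3 h4 hK fun h' => absurd h' h
    refine ⟨C, ?_, fun hx => nonSignalling_of_bipartiteChoi hK h2 hC (Or.inl ht) hx,
      fun hx => pptPreserving_of_bipartiteChoi hK h1 hC ht0 (Or.inl ht) hx.1 hx.2⟩
    rw [C.channelFidelity_overall, lamOp_of_bipartiteChoi hK hC, objective]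

/-- The completely mixed state and `Λ = ρ ⊗ 1 / K²` satisfy all the constraints. -/
lemma exists_feasible [Nonempty A'] (hK : 1 ≤ K) :
    ∃ x, x ∈ baseConstraints A' B ∧ x ∈ constraintNS A' B K ∧ x ∈ constraintPPTp A' B K := by
  have hK0 : (0 : ℝ) < K := by exact_mod_cast hK
  let ρ : Mat A' := (Fintype.card A' : ℂ)⁻¹ • 1
  have hρ : ρ.PosSemidef := Matrix.PosSemidef.one.smul (by positivity)
  have htr : ρ.trace = 1 := by
    simp [ρ, Matrix.trace_smul]
  have hρ1 : (ρ ⊗ₖ (1 : Mat B)).PosSemidef := posSemidef_kronecker hρ .one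
  have hΛ : (((K : ℂ) ^ 2)⁻¹ • (ρ ⊗ₖ (1 : Mat B))).PosSemidef := hρ1.smul (by positivity)
  have hinv : (K : ℝ)⁻¹ ≤ 1 := inv_le_one_of_one_le₀ (by exact_mod_cast hK)
  have hinv0 : 0 < (K : ℝ)⁻¹ := inv_pos.2 hK0
  have hscalar : ∀ c : ℝ, 0 ≤ c → ((c : ℂ) • (ρ ⊗ₖ (1 : Mat B))).PosSemidef := fun c hc =>
    hρ1.smul (Complex.zero_le_real.2 hc)
  have ht : transposeRight (((K : ℂ) ^ 2)⁻¹ • (ρ ⊗ₖ (1 : Mat B)))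
      = ((K : ℂ) ^ 2)⁻¹ • (ρ ⊗ₖ (1 : Mat B)) := by
    conv_rhs => rw [← transposeRight_kronecker_one]
    rfl
  refine ⟨(⟨ρ, hρ.isHermitian⟩, ⟨_, hΛ.isHermitian⟩), ⟨hρ, htr, hΛ, ?_⟩, ?_, ?_, ?_⟩
  · have h := hscalar (1 - ((K : ℝ)⁻¹) ^ 2) (by nlinarith)
    convert h using 1
    push_cast
    rw [sub_smul, one_smul, inv_pow]
  · ext b b'
    change ∑ p, ((K : ℂ) ^ 2)⁻¹ * (ρ p p * (1 : Mat B) b b') = _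
    rw [← Finset.mul_sum, ← Finset.sum_mul, show ∑ p, ρ p p = 1 from htr, one_mul]
    rfl
  · change (transposeRight (((K : ℂ) ^ 2)⁻¹ • (ρ ⊗ₖ (1 : Mat B)))
      - (-((K : ℂ)⁻¹ • (ρ ⊗ₖ (1 : Mat B))))).PosSemidef
    rw [ht, sub_neg_eq_add]
    exact hΛ.add (hρ1.smul (by positivity))
  · change ((K : ℂ)⁻¹ • (ρ ⊗ₖ (1 : Mat B))
      - transposeRight (((K : ℂ) ^ 2)⁻¹ • (ρ ⊗ₖ (1 : Mat B)))).PosSemidef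
    rw [ht]
    have h := hscalar ((K : ℝ)⁻¹ - ((K : ℝ)⁻¹) ^ 2) (by nlinarith)
    convert h using 1
    push_cast
    rw [sub_smul, inv_pow]

/-- If the codes of a class and the feasible points dominate one another, both optima are attained
and equal. -/
lemma optFidelity_of_feasible {Ω : Set (ForwardCode K A' B)} {N : Mat A' →ₗ[ℂ] Mat B}
    {s : Set (Vars A' B)} (hs : IsLMI s) (hsub : s ⊆ baseConstraints A' B) (hne : s.Nonempty)
    (h₁ : ∀ C ∈ Ω, ∃ x ∈ s, objective N x = channelFidelity (C.overall N))
    (h₂ : ∀ x ∈ s, ∃ C ∈ Ω, objective N x ≤ channelFidelity (C.overall N)) :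
    IsGreatest (fidelities Ω N) (optFidelity Ω N) ∧
      IsGreatest (objective N '' s) (optFidelity Ω N) ∧
      IsSemidefiniteProgram (objective N) s := by
  obtain ⟨x, hx, hmax⟩ := (isCompact_of_subset_baseConstraints hs hsub).exists_isMaxOn hne
    (continuous_objective N).continuousOn
  obtain ⟨C, hC, hxC⟩ := h₂ x hx
  have hub : ∀ C' ∈ Ω, channelFidelity (C'.overall N) ≤ objective N x := by
    intro C' hC'
    obtain ⟨y, hy, hyC⟩ := h₁ C' hC'
    rw [← hyC]
    exact hmax hy
  have heq : channelFidelity (C.overall N) = objective N x := le_antisymm (hub C hC) hxC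
  have hg : IsGreatest (fidelities Ω N) (objective N x) := by
    refine ⟨⟨C, hC, heq⟩, ?_⟩
    rintro _ ⟨C', hC', rfl⟩
    exact hub C' hC'
  have hopt : optFidelity Ω N = objective N x := hg.csSup_eq
  rw [hopt]
  refine ⟨hg, ⟨⟨x, hx, rfl⟩, ?_⟩, isSemidefiniteProgram_objective N hs⟩
  rintro _ ⟨y, hy, rfl⟩
  exact hmax hy

end Optimum

end

end QCode

theorem corollary1 {A' B : Type*} [Fintype A'] [Fintype B] [DecidableEq A'] [DecidableEq B]
    [Nonempty A'] (N : QCode.Mat A' →ₗ[ℂ] QCode.Mat B) (hN : QCode.IsOperation N)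
    (K : ℕ) (hK : 1 ≤ K) :
    -- non-signalling codes
    (IsGreatest (QCode.fidelities (QCode.codesNS K A' B) N)
        (QCode.optFidelity (QCode.codesNS K A' B) N) ∧
      IsGreatest (QCode.objective N ''
          (QCode.baseConstraints A' B ∩ QCode.constraintNS A' B K))
        (QCode.optFidelity (QCode.codesNS K A' B) N) ∧
      QCode.IsSemidefiniteProgram (QCode.objective N)
        (QCode.baseConstraints A' B ∩ QCode.constraintNS A' B K)) ∧
    -- PPT-preserving codes
    (IsGreatest (QCode.fidelities (QCode.codesPPTp K A' B) N)
        (QCode.optFidelity (QCode.codesPPTp K A' B) N) ∧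
      IsGreatest (QCode.objective N ''
          (QCode.baseConstraints A' B ∩ QCode.constraintPPTp A' B K))
        (QCode.optFidelity (QCode.codesPPTp K A' B) N) ∧
      QCode.IsSemidefiniteProgram (QCode.objective N)
        (QCode.baseConstraints A' B ∩ QCode.constraintPPTp A' B K)) ∧
    -- codes that are both non-signalling and PPT-preserving
    (IsGreatest (QCode.fidelities (QCode.codesNS K A' B ∩ QCode.codesPPTp K A' B) N)
        (QCode.optFidelity (QCode.codesNS K A' B ∩ QCode.codesPPTp K A' B) N) ∧
      IsGreatest (QCode.objective N ''
          (QCode.baseConstraints A' B ∩ QCode.constraintNS A' B K ∩ QCode.constraintPPTp A' B K))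
        (QCode.optFidelity (QCode.codesNS K A' B ∩ QCode.codesPPTp K A' B) N) ∧
      QCode.IsSemidefiniteProgram (QCode.objective N)
        (QCode.baseConstraints A' B ∩ QCode.constraintNS A' B K ∩
          QCode.constraintPPTp A' B K)) := by
  -- A trace-preserving map out of a non-zero system has a non-zero output system.
  have : Nonempty B := by
    by_contra hB
    rw [not_nonempty_iff] at hB
    have h := hN.tracePreserving ((Fintype.card A' : ℂ)⁻¹ • 1)
    simp [Matrix.trace_smul, Matrix.trace_eq_zero_of_isEmpty] at h
  obtain ⟨x₀, h0, h0NS, h0P⟩ := QCode.exists_feasible (A' := A') (B := B) hK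
  have hb := QCode.isLMI_baseConstraints (A' := A') (B := B)
  have hns := QCode.isLMI_constraintNS (A' := A') (B := B) K
  have hp := QCode.isLMI_constraintPPTp (A' := A') (B := B) K
  refine ⟨QCode.optFidelity_of_feasible (hb.inter hns) Set.inter_subset_left ⟨x₀, h0, h0NS⟩
      (fun C hC => ?_) (fun x hx => ?_),
    QCode.optFidelity_of_feasible (hb.inter hp) Set.inter_subset_left ⟨x₀, h0, h0P⟩
      (fun C hC => ?_) (fun x hx => ?_),
    QCode.optFidelity_of_feasible ((hb.inter hns).inter hp)
      (Set.inter_subset_left.trans Set.inter_subset_left) ⟨x₀, ⟨h0, h0NS⟩, h0P⟩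
      (fun C hC => ?_) (fun x hx => ?_)⟩
  · obtain ⟨x, hx, hval, hNS, -⟩ := QCode.exists_feasible_of_code hK N C
    exact ⟨x, ⟨hx, hNS hC⟩, hval⟩
  · obtain ⟨C, hval, hNS, -⟩ := QCode.exists_code_of_feasible hK hN hx.1
    exact ⟨C, hNS hx.2, hval⟩
  · obtain ⟨x, hx, hval, -, hP⟩ := QCode.exists_feasible_of_code hK N C
    exact ⟨x, ⟨hx, hP hC⟩, hval⟩
  · obtain ⟨C, hval, -, hP⟩ := QCode.exists_code_of_feasible hK hN hx.1
    exact ⟨C, hP hx.2, hval⟩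
  · obtain ⟨x, hx, hval, hNS, hP⟩ := QCode.exists_feasible_of_code hK N C
    exact ⟨x, ⟨⟨hx, hNS hC.1⟩, hP hC.2⟩, hval⟩
  · obtain ⟨C, hval, hNS, hP⟩ := QCode.exists_code_of_feasible hK hN hx.1.1
    exact ⟨C, ⟨hNS hx.1.2, hP hx.2⟩, hval⟩
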